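/- Let $\mathbf{SU}(2)$ be the group of $2\times 2$ complex unitary matrices of determinant $1$, with normalized Haar measure $\mu$, and let $$X=\begin{pmatrix}0&1\\-1&0\end{pmatrix},\qquad Y=\begin{pmatrix}0&i\\ i&0\end{pmatrix},\qquad Z=\begin{pmatrix}i&0\\0&-i\end{pmatrix}.$$ Denote also by $X,Y$ the corresponding left-invariant vector fields, $(Xf)(g)=\frac{d}{ds}\big|_{s=0}f(g\,e^{sX})$ and likewise for $Y$, and let $\mathcal L=X^2+Y^2$. There is exactly one strongly continuous semigroup $(P_t)_{t\ge 0}$ of bounded operators on $C(\mathbf{SU}(2),\mathbb R)$ whose infinitesimal generator extends $\mathcal L$ on smooth functions; it is the heat semigroup $P_t=e^{t\mathcal L}$. For every $t>0$ there is a continuous function $p_t$ on $\mathbf{SU}(2)$ with $$(P_tf)(1)=\int_{\mathbf{SU}(2)}p_t\,f\,d\mu\qquad\text{for all } f\in C(\mathbf{SU}(2),\mathbb R)$$ (the subelliptic heat kernel issued from the identity). Use the cylindric coordinates $$(r,\theta,z)\mapsto \exp(r\cos\theta\, X+r\sin\theta\, Y)\exp(zZ).$$ Then, for any such $p_t$ and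 all $t>0$, $0\le r<\frac{\pi}{2}$, $\theta\in[0,2\pi]$, $z\in[-\pi,\pi]$, the value of $p_t$ at the point with coordinates $(r,\theta,z)$ does not depend on $\theta$ and, denoted by $p_t(r,z)$, equals $$p_t(r,z)=\sum_{n\in\mathbb Z}\sum_{k=0}^{\infty}(2k+|n|+1)\,e^{-(4k(k+|n|+1)+2|n|)t}\,e^{inz}(\cos r)^{|n|}P_k^{0,|n|}(\cos 2r),$$ where the double series converges absolutely and $$P_k^{0,|n|}(x)=\frac{(-1)^k}{2^k\,k!\,(1+x)^{|n|}}\frac{d^k}{dx^k}\Big((1+x)^{|n|}(1-x^2)^k\Big)$$ is a Jacobi polynomial. -/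

import Mathlib

open scoped NNReal Topology ContDiff

/-- The group `SU(2)` of `2 × 2` complex unitary matrices of determinant one. -/
abbrev SU2 : Type := Matrix.specialUnitaryGroup (Fin 2) ℂ

instance SU2.instContinuousInv : ContinuousInv SU2 where
  continuous_inv := by
    refine Continuous.subtype_mk (f := fun x : SU2 => star (x : Matrix (Fin 2) (Fin 2) ℂ)) ?_ _
    exact continuous_star.comp continuous_subtype_val

instance SU2.instIsTopologicalGroup : IsTopologicalGroup SU2 where

instance SU2.instCompactSpace : CompactSpace SU2 := by
  refine isCompact_iff_compactSpace.mp (?_ : IsCompact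
    (Matrix.specialUnitaryGroup (Fin 2) ℂ : Set (Matrix (Fin 2) (Fin 2) ℂ)))
  have hK : IsCompact (Set.pi Set.univ (fun _ : Fin 2 => Set.pi Set.univ
      (fun _ : Fin 2 => Metric.closedBall (0 : ℂ) 1))) :=
    isCompact_univ_pi fun _ => isCompact_univ_pi fun _ => isCompact_closedBall 0 1
  refine IsCompact.of_isClosed_subset hK ?_ ?_
  · have h : (Matrix.specialUnitaryGroup (Fin 2) ℂ : Set (Matrix (Fin 2) (Fin 2) ℂ)) =
        {A | star A * A = 1} ∩ ({A | A * star A = 1} ∩ {A | A.det = 1}) := by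
      ext A
      simp [Matrix.mem_specialUnitaryGroup_iff, Matrix.unitaryGroup, Unitary.mem_iff, and_assoc]
    rw [h]
    refine (isClosed_eq (by fun_prop) continuous_const).inter
      ((isClosed_eq (by fun_prop) continuous_const).inter
        (isClosed_eq (by fun_prop) continuous_const))
  · intro A hA i _ j _
    simpa using entry_norm_bound_of_unitary
      (Matrix.specialUnitaryGroup_le_unitaryGroup hA) i j

noncomputable instance SU2.instMeasurableSpace : MeasurableSpace SU2 := borel SU2

instance SU2.instBorelSpace : BorelSpace SU2 := ⟨rfl⟩

/-- The normalized (total mass one) bi-invariant Haar measure of `SU(2)`. -/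
noncomputable def SU2.haar : MeasureTheory.Measure SU2 := MeasureTheory.Measure.haarMeasure ⊤

/-- The matrix `a X + b Y + c Z` of the Lie algebra `su(2)`, where
`X = !![0, 1; -1, 0]`, `Y = !![0, i; i, 0]` and `Z = !![i, 0; 0, -i]`. -/
noncomputable def su2Mat (a b c : ℝ) : Matrix (Fin 2) (Fin 2) ℂ :=
  (a : ℂ) • !![0, 1; -1, 0] + (b : ℂ) • !![0, Complex.I; Complex.I, 0]
    + (c : ℂ) • !![Complex.I, 0; 0, -Complex.I]

theorem exp_su2Mat_mem (a b c : ℝ) :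
    NormedSpace.exp (su2Mat a b c) ∈ Matrix.specialUnitaryGroup (Fin 2) ℂ := by
  have hstar : star (su2Mat a b c) = -su2Mat a b c := by
    ext i j
    fin_cases i <;> fin_cases j <;> simp [su2Mat, Matrix.star_apply] <;> ring
  have hmul : NormedSpace.exp (su2Mat a b c) * NormedSpace.exp (-su2Mat a b c) = 1 := by
    rw [← Matrix.exp_add_of_commute _ _ (Commute.neg_right (Commute.refl (su2Mat a b c))), add_neg_cancel,
      NormedSpace.exp_zero]
  have hmul' : NormedSpace.exp (-su2Mat a b c) * NormedSpace.exp (su2Mat a b c) = 1 := by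
    rw [← Matrix.exp_add_of_commute _ _ (Commute.neg_left (Commute.refl (su2Mat a b c))), neg_add_cancel,
      NormedSpace.exp_zero]
  have hse : star (NormedSpace.exp (su2Mat a b c)) = NormedSpace.exp (-su2Mat a b c) := by
    rw [Matrix.star_eq_conjTranspose, ← Matrix.exp_conjTranspose, ← Matrix.star_eq_conjTranspose,
      hstar]
  rw [Matrix.mem_specialUnitaryGroup_iff]
  refine ⟨?_, ?_⟩
  · rw [Matrix.unitaryGroup, Unitary.mem_iff, hse]
    exact ⟨hmul', hmul⟩
  · set J : Matrix (Fin 2) (Fin 2) ℂ := !![0, 1; -1, 0] with hJ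
    have hJdet : IsUnit J := by
      rw [Matrix.isUnit_iff_isUnit_det, hJ]
      simp
    have hJJ : J * J = -1 := by
      ext i j
      fin_cases i <;> fin_cases j <;> simp [hJ, Matrix.mul_apply, Fin.sum_univ_two]
    have hinv : J⁻¹ = -J := by
      apply Matrix.inv_eq_right_inv
      rw [mul_neg, hJJ, neg_neg]
    have hadj : ∀ A : Matrix (Fin 2) (Fin 2) ℂ, A.adjugate = J * A.transpose * J⁻¹ := by
      intro A
      rw [hinv, Matrix.adjugate_fin_two]
      ext i j
      fin_cases i <;> fin_cases j <;>
        simp [hJ, Matrix.mul_apply, Matrix.vecMul, dotProduct, Fin.sum_univ_two]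
    have h1 : (su2Mat a b c).adjugate = -su2Mat a b c := by
      rw [Matrix.adjugate_fin_two]
      ext i j
      fin_cases i <;> fin_cases j <;> simp [su2Mat]
    have h2 : (NormedSpace.exp (su2Mat a b c)).adjugate = NormedSpace.exp (-su2Mat a b c) := by
      rw [hadj, ← Matrix.exp_transpose, ← Matrix.exp_conj _ _ hJdet, ← hadj, h1]
    have h3 := Matrix.mul_adjugate (NormedSpace.exp (su2Mat a b c))
    rw [h2, hmul] at h3
    have h4 := congrFun (congrFun h3 0) 0
    simpa using h4.symm

/-- The group element `exp (a X + b Y + c Z)` of `SU(2)`. -/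
noncomputable def SU2.exp (a b c : ℝ) : SU2 :=
  ⟨NormedSpace.exp (su2Mat a b c), exp_su2Mat_mem a b c⟩

/-- The point of `SU(2)` with cylindric coordinates `(r, θ, z)`. -/
noncomputable def SU2.cyl (r θ z : ℝ) : SU2 :=
  SU2.exp (r * Real.cos θ) (r * Real.sin θ) 0 * SU2.exp 0 0 z

/-- Smooth functions on `SU(2)`: restrictions of smooth functions of the four complex matrix
entries, `SU(2)` being a closed embedded submanifold of the space of matrices. -/
def SU2.IsSmooth (f : SU2 → ℝ) : Prop :=
  ∃ F : (Fin 2 → Fin 2 → ℂ) → ℝ, ContDiff ℝ ∞ F ∧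
    ∀ g : SU2, f g = F (fun i j => (g : Matrix (Fin 2) (Fin 2) ℂ) i j)

/-- The left invariant vector field `a X + b Y + c Z` acting on functions:
the derivative at `s = 0` of `f (g exp (s (a X + b Y + c Z)))`. -/
noncomputable def SU2.vectorField (a b c : ℝ) (f : SU2 → ℝ) (g : SU2) : ℝ :=
  deriv (fun s : ℝ => f (g * SU2.exp (s * a) (s * b) (s * c))) 0

/-- The sublaplacian `L = X² + Y²`. -/
noncomputable def SU2.sublaplacian (f : SU2 → ℝ) (g : SU2) : ℝ :=
  SU2.vectorField 1 0 0 (SU2.vectorField 1 0 0 f) g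
    + SU2.vectorField 0 1 0 (SU2.vectorField 0 1 0 f) g

/-- `P` is the heat semigroup `P_t = e^{tL}` on the Banach space of continuous functions on
`SU(2)`: the strongly continuous semigroup of bounded operators whose infinitesimal generator
extends the sublaplacian `L` on smooth functions. (As smooth functions are a core,
the generator is then the closure of `L`, and there is only one such semigroup.) -/
structure SU2.IsHeatSemigroup (P : ℝ≥0 → (C(SU2, ℝ) →L[ℝ] C(SU2, ℝ))) : Prop where
  zero : P 0 = ContinuousLinearMap.id ℝ C(SU2, ℝ)
  add : ∀ s t : ℝ≥0, P (s + t) = (P s).comp (P t)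
  strongly_continuous : ∀ f : C(SU2, ℝ), Continuous fun t : ℝ≥0 => P t f
  generator : ∀ f : C(SU2, ℝ), SU2.IsSmooth f →
    TendstoUniformly (fun (t : ℝ≥0) (g : SU2) => (P t f g - f g) / (t : ℝ))
      (SU2.sublaplacian f) (𝓝[>] 0)

/-- `p t` is, for each `t > 0`, the continuous density of `f ↦ (P_t f)(1)` with respect to the
normalized Haar measure: `p` is the kernel issued from the identity of the semigroup `P`. -/
def SU2.IsKernelFromOne (P : ℝ≥0 → (C(SU2, ℝ) →L[ℝ] C(SU2, ℝ))) (p : ℝ≥0 → SU2 → ℝ) : Prop :=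
  ∀ t : ℝ≥0, 0 < t → Continuous (p t) ∧
    ∀ f : C(SU2, ℝ), P t f 1 = ∫ g, p t g * f g ∂SU2.haar

/-- The Jacobi polynomial `P_k^{0,m}`, by Rodrigues' formula (used for `x ≠ -1`). -/
noncomputable def jacobiP (k m : ℕ) (x : ℝ) : ℝ :=
  (-1) ^ k / (2 ^ k * (k.factorial : ℝ) * (1 + x) ^ m) *
    iteratedDeriv k (fun y : ℝ => (1 + y) ^ m * (1 - y ^ 2) ^ k) x

/-!
The zonal functions of the irreducible representations of `SU(2)` are polynomials in the matrix
entries `α`, `β` and their conjugates, are bounded by `1`, and are eigenfunctions of `L`. Since `L`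
is symmetric and preserves the degree of a polynomial, the polynomial eigenfunctions of `L` span all
polynomials, a dense subspace of the continuous functions. On polynomials the zonal expansion at the
identity is an inversion formula, checked on monomials by a telescoping sum. Hence convolution with
`p_t = ∑ dim · exp (-λ t) · zonal` multiplies an eigenfunction of eigenvalue `μ` by `exp (μ t)`, and
it is a contraction by the parabolic maximum principle; this gives the heat semigroup. Any other
semigroup whose generator extends `L` acts in the same way on eigenfunctions, hence everywhere.
In cylindric coordinates `α = cos r · exp (i z)`, and the zonal functions become
`exp (i n z) (cos r) ^ |n|` times Jacobi polynomials.
-/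

open ComplexConjugate MeasureTheory

section Calculus

theorem deriv_deriv_nonpos_of_isLocalMax {u : ℝ → ℝ} {x : ℝ} (hu : IsLocalMax u x)
    (hc : ContinuousAt u x) : deriv (deriv u) x ≤ 0 := by
  by_contra! hpos
  have hmin : IsLocalMin u x := isLocalMin_of_deriv_deriv_pos hpos hu.deriv_eq_zero hc
  have hconst : u =ᶠ[𝓝 x] fun _ => u x := by
    filter_upwards [hu, hmin] with s hle hge using le_antisymm hle hge
  simp [hconst.deriv.deriv_eq] at hpos

theorem nonneg_of_hasDerivAt_of_forall_le {v : ℝ → ℝ} {v' r s : ℝ} (hv : HasDerivAt v v' s)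
    (hrs : r < s) (hmax : ∀ x ∈ Set.Ico r s, v x ≤ v s) : 0 ≤ v' := by
  have hslope : Filter.Tendsto (slope v s) (𝓝[<] s) (𝓝 v') :=
    (hasDerivAt_iff_tendsto_slope.1 hv).mono_left
      (nhdsWithin_mono _ fun _ hx => ne_of_lt hx)
  refine ge_of_tendsto hslope ?_
  filter_upwards [Ico_mem_nhdsLT hrs] with x hx
  rw [slope_def_field]
  exact div_nonneg_of_nonpos (sub_nonpos.2 (hmax x hx)) (sub_nonpos.2 hx.2.le)

theorem hasDerivAt_tsum_mul_exp_neg {ι : Type*} {c a : ι → ℝ} (ha : ∀ i, 0 ≤ a i) {s t : ℝ}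
    (hst : s < t) (hsum : Summable fun i => c i * Real.exp (-a i * t))
    (hsum' : Summable fun i => a i * c i * Real.exp (-a i * s)) :
    HasDerivAt (fun x => ∑' i, c i * Real.exp (-a i * x))
      (∑' i, -a i * c i * Real.exp (-a i * t)) t := by
  refine hasDerivAt_tsum_of_isPreconnected (g := fun i x => c i * Real.exp (-a i * x))
    (g' := fun i x => -a i * c i * Real.exp (-a i * x)) hsum'.norm isOpen_Ioi
    isPreconnected_Ioi (fun i x _ => ?_) (fun i x hx => ?_) (Set.mem_Ioi.2 hst) hsum
    (Set.mem_Ioi.2 hst)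
  · refine ((((hasDerivAt_id x).const_mul (-a i)).exp).const_mul (c i)).congr_deriv ?_
    simp only [id]
    ring
  · rw [norm_mul, norm_mul, norm_mul, norm_mul, norm_neg, Real.norm_of_nonneg (Real.exp_nonneg _),
      Real.norm_of_nonneg (Real.exp_nonneg _)]
    have hle : -a i * x ≤ -a i * s :=
      mul_le_mul_of_nonpos_left hx.le (neg_nonpos.2 (ha i))
    gcongr

theorem iteratedDeriv_add_one_pow_mul_sub_one_pow (k m : ℕ) (x : ℝ) :
    iteratedDeriv k (fun y : ℝ => (y + 1) ^ (m + k) * (y - 1) ^ k) x =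
      k.factorial * ∑ s ∈ Finset.range (k + 1), ((m + k).choose s : ℝ) * k.choose s *
        (x + 1) ^ (m + k - s) * (x - 1) ^ s := by
  rw [iteratedDeriv_fun_mul (by fun_prop) (by fun_prop), Finset.mul_sum]
  refine Finset.sum_congr rfl fun s hs => ?_
  have hs : s ≤ k := Finset.mem_range_succ_iff.1 hs
  have hfactorial : (m + k).descFactorial s * k.descFactorial (k - s) =
      k.factorial * (m + k).choose s := by
    have h := Nat.factorial_mul_descFactorial (Nat.sub_le k s)
    rw [Nat.sub_sub_self hs] at h
    rw [Nat.descFactorial_eq_factorial_mul_choose, ← h]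
    ring
  rw [iteratedDeriv_comp_add_const s (· ^ (m + k)), iteratedDeriv_comp_sub_const (k - s) (· ^ k)]
  simp only [iteratedDeriv_pow, Nat.sub_sub_self hs]
  have hcast : ((m + k).descFactorial s : ℝ) * k.descFactorial (k - s) =
      k.factorial * (m + k).choose s := mod_cast hfactorial
  linear_combination (k.choose s : ℝ) * (x + 1) ^ (m + k - s) * (x - 1) ^ s * hcast

theorem jacobiP_eq_sum (k m : ℕ) {u : ℝ} (hu : u ≠ 0) : jacobiP k m (2 * u - 1) =
    ∑ s ∈ Finset.range (k + 1),
      ((m + k).choose s : ℝ) * k.choose s * u ^ (k - s) * (u - 1) ^ s := by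
  have hrodrigues : (fun y : ℝ => (1 + y) ^ m * (1 - y ^ 2) ^ k) = fun y =>
      (-1) ^ k * ((y + 1) ^ (m + k) * (y - 1) ^ k) := by
    ext y
    rw [show 1 - y ^ 2 = -1 * (y + 1) * (y - 1) by ring, mul_pow, mul_pow]
    ring
  have hsign : (-1 : ℝ) ^ k * (-1) ^ k = 1 := by rw [← mul_pow]; norm_num
  rw [jacobiP, hrodrigues, iteratedDeriv_const_mul_field,
    iteratedDeriv_add_one_pow_mul_sub_one_pow, Finset.mul_sum, Finset.mul_sum, Finset.mul_sum]
  refine Finset.sum_congr rfl fun s hs => ?_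
  obtain ⟨j, rfl⟩ := Nat.exists_eq_add_of_le (Finset.mem_range_succ_iff.1 hs)
  rw [Nat.add_sub_cancel_left, show m + (s + j) - s = m + j by omega,
    show 2 * u - 1 + 1 = 2 * u by ring, show 2 * u - 1 - 1 = 2 * (u - 1) by ring,
    add_sub_cancel]
  simp only [mul_pow, pow_add] at hsign ⊢
  field_simp
  linear_combination (u - 1) ^ s * ((s + j).choose s : ℝ) * ((m + (s + j)).choose s) * hsign

end Calculus

section BinomialSums

theorem fwdDiff_iter_choose_of_lt {p k : ℕ} (h : p < k) :
    (fwdDiff 1)^[k] (fun x ↦ x.choose p : ℕ → ℤ) = fun _ => 0 := by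
  obtain ⟨j, rfl⟩ := Nat.exists_eq_add_of_lt h
  have hp : (fwdDiff 1)^[p] (fun x ↦ x.choose p : ℕ → ℤ) = fun _ => 1 := by
    simpa using fwdDiff_iter_choose 0 p
  rw [show p + j + 1 = j + 1 + p by ring, Function.iterate_add_apply, hp,
    Function.iterate_succ_apply, fwdDiff_const, Function.iterate_fixed (fwdDiff_const 1 0)]

theorem alternating_sum_choose (k p M : ℕ) :
    ∑ s ∈ Finset.range (k + 1), (-1 : ℤ) ^ s * k.choose s * (M + (k - s)).choose p =
      if k ≤ p then (M.choose (p - k) : ℤ) else 0 := by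
  calc ∑ s ∈ Finset.range (k + 1), (-1 : ℤ) ^ s * k.choose s * (M + (k - s)).choose p
      = (fwdDiff 1)^[k] (fun x ↦ x.choose p : ℕ → ℤ) M := by
        rw [fwdDiff_iter_eq_sum_shift, ← Finset.sum_flip]
        refine Finset.sum_congr rfl fun s hs => ?_
        have hs : s ≤ k := Finset.mem_range_succ_iff.1 hs
        simp [Nat.choose_symm hs, Nat.sub_sub_self hs]
    _ = if k ≤ p then (M.choose (p - k) : ℤ) else 0 := by
        split_ifs with hk
        · obtain ⟨j, rfl⟩ := Nat.exists_eq_add_of_le hk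
          simp [fwdDiff_iter_choose]
        · rw [fwdDiff_iter_choose_of_lt (not_le.1 hk)]

theorem sum_descFactorial_div_factorial (n p K : ℕ) :
    ∑ k ∈ Finset.range K, (2 * k + n + 1 : ℂ) *
      ((p.descFactorial k * (n + p).factorial : ℂ) / ((n + p + k + 1).factorial : ℂ)) =
    1 - (p.descFactorial K * (n + p).factorial : ℂ) / ((n + p + K).factorial : ℂ) := by
  induction K with
  | zero => simp [Nat.factorial_ne_zero]
  | succ K ih =>
    rw [Finset.sum_range_succ, ih, Nat.descFactorial_succ, ← add_assoc,
      Nat.factorial_succ (n + p + K)]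
    have hfact : ((n + p + K).factorial : ℂ) ≠ 0 := Nat.cast_ne_zero.2 (Nat.factorial_ne_zero _)
    have hsucc : ((n : ℂ) + p + K + 1) ≠ 0 := mod_cast Nat.succ_ne_zero (n + p + K)
    rcases le_or_gt K p with hK | hK
    · push_cast [hK]
      field_simp
      ring
    · simp [Nat.descFactorial_of_lt hK]

end BinomialSums

section Diagonalization

theorem iSup_eigenspace_eq_top_of_symmetric {V : Type*} [AddCommGroup V] [Module ℝ V]
    [FiniteDimensional ℝ V] (B : LinearMap.BilinForm ℝ V) (hB : ∀ x y, B x y = B y x)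
    (hpos : ∀ x ≠ 0, 0 < B x x) {T : Module.End ℝ V} (hT : ∀ x y, B (T x) y = B x (T y)) :
    ⨆ μ, T.eigenspace μ = ⊤ := by
  have hnonneg (x : V) : 0 ≤ B x x := by
    rcases eq_or_ne x 0 with rfl | hx
    · simp
    · exact (hpos x hx).le
  let core : InnerProductSpace.Core ℝ V :=
    { inner := fun x y => B x y
      conj_inner_symm := fun x y => hB y x
      re_inner_nonneg := hnonneg
      add_left := fun x y z => by simp
      smul_left := fun x y c => by simp
      definite := fun x hx => by_contra fun hne => (hpos x hne).ne' hx }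
  let _ : NormedAddCommGroup V := core.toNormedAddCommGroup
  let _ : InnerProductSpace ℝ V := .ofCore core.toCore
  have hsymm : T.IsSymmetric := hT
  exact Submodule.orthogonal_eq_bot_iff.1 hsymm.orthogonalComplement_iSup_eigenspaces_eq_bot

end Diagonalization

section Semigroup

variable {E : Type*} [NormedAddCommGroup E] [NormedSpace ℝ E] {P : ℝ≥0 → E →L[ℝ] E} {f : E}

theorem hasDerivWithinAt_Ici_of_tendsto_generator (hadd : ∀ s t, P (s + t) = (P s).comp (P t))
    {f' : E} (hgen : Filter.Tendsto (fun t : ℝ≥0 => (t : ℝ)⁻¹ • (P t f - f)) (𝓝[>] 0) (𝓝 f'))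
    {x : ℝ} (hx : 0 ≤ x) :
    HasDerivWithinAt (fun s : ℝ => P s.toNNReal f) (P x.toNNReal f') (Set.Ici x) x := by
  rw [← hasDerivWithinAt_Ioi_iff_Ici, hasDerivWithinAt_iff_tendsto_slope' Set.self_notMem_Ioi]
  have hincrement : Filter.Tendsto (fun y : ℝ => (y - x).toNNReal) (𝓝[>] x) (𝓝[>] 0) := by
    refine tendsto_nhdsWithin_iff.2 ⟨?_, ?_⟩
    · have hcont : Continuous fun y : ℝ => (y - x).toNNReal := by fun_prop
      simpa using (hcont.tendsto x).mono_left nhdsWithin_le_nhds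
    · filter_upwards [self_mem_nhdsWithin] with y hy
      exact Real.toNNReal_pos.2 (sub_pos.2 hy)
  refine (((P x.toNNReal).continuous.tendsto f').comp (hgen.comp hincrement)).congr' ?_
  filter_upwards [self_mem_nhdsWithin] with y hy
  have hyx : 0 ≤ y - x := (sub_pos.2 hy).le
  have hy_eq : y.toNNReal = x.toNNReal + (y - x).toNNReal := by
    rw [← Real.toNNReal_add hx hyx, add_sub_cancel]
  simp only [Function.comp, slope, hy_eq, hadd, ContinuousLinearMap.comp_apply, vsub_eq_sub,
    map_smul, map_sub, Real.coe_toNNReal _ hyx]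

theorem semigroup_apply_eq_exp_smul (hzero : P 0 = ContinuousLinearMap.id ℝ E)
    (hadd : ∀ s t, P (s + t) = (P s).comp (P t)) (hcont : Continuous fun t => P t f) {μ : ℝ}
    (hgen : Filter.Tendsto (fun t : ℝ≥0 => (t : ℝ)⁻¹ • (P t f - f)) (𝓝[>] 0) (𝓝 (μ • f)))
    (t : ℝ≥0) : P t f = Real.exp (μ * t) • f := by
  have hcont' : Continuous fun s : ℝ => Real.exp (-μ * s) • P s.toNNReal f :=
    (Real.continuous_exp.comp (continuous_const_mul (-μ))).smul
      (hcont.comp continuous_real_toNNReal)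
  have hderiv : ∀ x ∈ Set.Ico (0 : ℝ) t, HasDerivWithinAt
      (fun s : ℝ => Real.exp (-μ * s) • P s.toNNReal f) 0 (Set.Ici x) x := fun x hx => by
    have hexp : HasDerivAt (fun s : ℝ => Real.exp (-μ * s)) (Real.exp (-μ * x) * -μ) x := by
      simpa using ((hasDerivAt_id x).const_mul (-μ)).exp
    refine (hexp.hasDerivWithinAt.fun_smul
      (hasDerivWithinAt_Ici_of_tendsto_generator hadd hgen hx.1)).congr_deriv ?_
    rw [map_smul]
    module
  have hconst : Real.exp (-μ * t) • P t f = f := by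
    simpa [hzero] using
      constant_of_has_deriv_right_zero hcont'.continuousOn hderiv t ⟨t.2, le_rfl⟩
  calc P t f = Real.exp (μ * t) • Real.exp (-μ * t) • P t f := by
        rw [smul_smul, ← Real.exp_add, neg_mul, add_neg_cancel, Real.exp_zero, one_smul]
    _ = Real.exp (μ * t) • f := by rw [hconst]

end Semigroup

section MatrixExponential

open NormedSpace

theorem exp_smul_of_mul_self_eq_neg_one {A : Type*} [NormedRing A] [NormedAlgebra ℝ A] {u : A}
    (hu : u * u = -1) (s : ℝ) :
    exp (s • u) = Real.cos s • (1 : A) + Real.sin s • u := by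
  let _ : NormedAlgebra ℚ A := NormedAlgebra.restrictScalars ℚ ℝ A
  let φ : ℂ →ₐ[ℝ] A := Complex.lift ⟨u, hu⟩
  have hφ (w : ℂ) : φ w = w.re • (1 : A) + w.im • u := by
    simp [φ, Complex.liftAux_apply, Algebra.algebraMap_eq_smul_one]
  have hcont : Continuous φ := φ.toLinearMap.continuous_of_finiteDimensional
  calc exp (s • u) = exp (φ (s * Complex.I)) := by simp [hφ]
    _ = φ (exp (s * Complex.I)) := (map_exp φ hcont _).symm
    _ = Real.cos s • (1 : A) + Real.sin s • u := by
      rw [hφ, ← Complex.exp_eq_exp_ℂ, Complex.exp_ofReal_mul_I_re, Complex.exp_ofReal_mul_I_im]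

open scoped Matrix.Norms.Operator in
theorem hasDerivAt_matrix_exp_smul_apply {n : Type*} [Fintype n] [DecidableEq n]
    (A : Matrix n n ℂ) (i j : n) :
    HasDerivAt (fun s : ℝ => exp (s • A) i j) (A i j) 0 := by
  have h := hasDerivAt_exp_smul_const (𝕂 := ℝ) A 0
  rw [zero_smul, exp_zero, one_mul] at h
  exact (Matrix.entryLinearMap ℝ ℂ i j).toContinuousLinearMap.hasFDerivAt.comp_hasDerivAt 0 h

theorem su2Mat_eq (a b c : ℝ) :
    su2Mat a b c = !![Complex.I * c, a + Complex.I * b; -a + Complex.I * b, -(Complex.I * c)] := by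
  ext i j
  fin_cases i <;> fin_cases j <;> simp [su2Mat, mul_comm]

theorem su2Mat_smul (s a b c : ℝ) : su2Mat (s * a) (s * b) (s * c) = s • su2Mat a b c := by
  ext i j
  fin_cases i <;> fin_cases j <;> simp [su2Mat_eq] <;> ring

theorem su2Mat_mul_self (a b c : ℝ) :
    su2Mat a b c * su2Mat a b c = -((a ^ 2 + b ^ 2 + c ^ 2) • 1) := by
  ext i j
  fin_cases i <;> fin_cases j <;>
    simp [su2Mat_eq, Matrix.mul_apply, Fin.sum_univ_two] <;> ring_nf <;>
    simp only [Complex.I_sq] <;> ring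

open scoped Matrix.Norms.Operator in
theorem exp_su2Mat {a b c : ℝ} (h : a ^ 2 + b ^ 2 + c ^ 2 = 1) (s : ℝ) :
    exp (su2Mat (s * a) (s * b) (s * c)) =
      Real.cos s • (1 : Matrix (Fin 2) (Fin 2) ℂ) + Real.sin s • su2Mat a b c := by
  rw [su2Mat_smul]
  exact exp_smul_of_mul_self_eq_neg_one (by rw [su2Mat_mul_self, h, one_smul]) s

end MatrixExponential

namespace SU2

section Coordinates

/-- The upper left entry of a matrix in `SU(2)`. -/
def α (g : SU2) : ℂ := (g : Matrix (Fin 2) (Fin 2) ℂ) 0 0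

/-- The upper right entry of a matrix in `SU(2)`. -/
def β (g : SU2) : ℂ := (g : Matrix (Fin 2) (Fin 2) ℂ) 0 1

theorem adjugate_eq_star (g : SU2) :
    (g : Matrix (Fin 2) (Fin 2) ℂ).adjugate = star (g : Matrix (Fin 2) (Fin 2) ℂ) := by
  obtain ⟨hu, hd⟩ := Matrix.mem_specialUnitaryGroup_iff.mp g.2
  have h1 : star (g : Matrix (Fin 2) (Fin 2) ℂ) * g = 1 := (Unitary.mem_iff.mp hu).1
  calc (g : Matrix (Fin 2) (Fin 2) ℂ).adjugate
      = star (g : Matrix (Fin 2) (Fin 2) ℂ) * g * (g : Matrix (Fin 2) (Fin 2) ℂ).adjugate := by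
        rw [h1, one_mul]
    _ = _ := by rw [mul_assoc, Matrix.mul_adjugate, hd, one_smul, mul_one]

theorem coe_eq (g : SU2) :
    (g : Matrix (Fin 2) (Fin 2) ℂ) = !![α g, β g; -conj (β g), conj (α g)] := by
  have h := adjugate_eq_star g
  rw [Matrix.adjugate_fin_two] at h
  have h0 : (g : Matrix (Fin 2) (Fin 2) ℂ) 1 1 = conj (α g) := congrFun₂ h 0 0
  have h1 : -(g : Matrix (Fin 2) (Fin 2) ℂ) 1 0 = conj (β g) := congrFun₂ h 1 0
  rw [Matrix.eta_fin_two (g : Matrix (Fin 2) (Fin 2) ℂ), h0, ← h1, neg_neg]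
  rfl

theorem α_mul (g h : SU2) : α (g * h) = α g * α h - β g * conj (β h) := by
  have hmul : α (g * h) = ((g : Matrix (Fin 2) (Fin 2) ℂ) * h) 0 0 := rfl
  rw [hmul, coe_eq g, coe_eq h]
  simp [sub_eq_add_neg]

theorem β_mul (g h : SU2) : β (g * h) = α g * β h + β g * conj (α h) := by
  have hmul : β (g * h) = ((g : Matrix (Fin 2) (Fin 2) ℂ) * h) 0 1 := rfl
  rw [hmul, coe_eq g, coe_eq h]
  simp

theorem α_one : α 1 = 1 := by simp [α]

theorem β_one : β 1 = 0 := by simp [β]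

theorem α_mul_conj_add (g : SU2) : α g * conj (α g) + β g * conj (β g) = 1 := by
  have hd := (Matrix.mem_specialUnitaryGroup_iff.mp g.2).2
  rwa [coe_eq, Matrix.det_fin_two_of, mul_neg, sub_neg_eq_add] at hd

theorem continuous_α : Continuous α :=
  (continuous_apply_apply (0 : Fin 2) (0 : Fin 2)).comp continuous_subtype_val

theorem continuous_β : Continuous β :=
  (continuous_apply_apply (0 : Fin 2) (1 : Fin 2)).comp continuous_subtype_val

theorem ext_αβ {g h : SU2} (hα : α g = α h) (hβ : β g = β h) : g = h := by
  rw [Subtype.ext_iff, coe_eq g, coe_eq h, hα, hβ]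

theorem α_exp {a b c : ℝ} (h : a ^ 2 + b ^ 2 + c ^ 2 = 1) (s : ℝ) :
    α (SU2.exp (s * a) (s * b) (s * c)) = Real.cos s + Complex.I * c * Real.sin s := by
  simp only [α, SU2.exp, exp_su2Mat h]
  simp [su2Mat_eq, mul_comm]

theorem β_exp {a b c : ℝ} (h : a ^ 2 + b ^ 2 + c ^ 2 = 1) (s : ℝ) :
    β (SU2.exp (s * a) (s * b) (s * c)) = (a + Complex.I * b) * Real.sin s := by
  simp only [β, SU2.exp, exp_su2Mat h]
  simp [su2Mat_eq, add_mul, mul_comm (Complex.sin _)]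

theorem α_exp_vertical (z : ℝ) : α (SU2.exp 0 0 z) = Complex.exp (Complex.I * z) := by
  have h := α_exp (a := 0) (b := 0) (c := 1) (by norm_num) z
  simp only [mul_zero, mul_one] at h
  rw [h, mul_comm Complex.I (z : ℂ), Complex.exp_mul_I]
  push_cast
  ring

theorem β_exp_vertical (z : ℝ) : β (SU2.exp 0 0 z) = 0 := by
  simpa using β_exp (a := 0) (b := 0) (c := 1) (by norm_num) z

theorem α_cyl (r θ z : ℝ) :
    α (SU2.cyl r θ z) = Real.cos r * Complex.exp (Complex.I * z) := by
  have h := α_exp (a := Real.cos θ) (b := Real.sin θ) (c := 0) (by simp) r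
  simp only [mul_zero, Complex.ofReal_zero, zero_mul, add_zero] at h
  rw [cyl, α_mul, h, α_exp_vertical, β_exp_vertical, map_zero, mul_zero, sub_zero]

end Coordinates

section Flow

variable {E : Type*} [NormedAddCommGroup E] [NormedSpace ℝ E] {a b c : ℝ}

/-- The one-parameter subgroup `s ↦ exp (s (a X + b Y + c Z))`. -/
noncomputable def flow (a b c s : ℝ) : SU2 := SU2.exp (s * a) (s * b) (s * c)

theorem coe_flow (a b c s : ℝ) :
    (flow a b c s : Matrix (Fin 2) (Fin 2) ℂ) = NormedSpace.exp (s • su2Mat a b c) := by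
  rw [← su2Mat_smul]
  rfl

theorem flow_zero (a b c : ℝ) : flow a b c 0 = 1 :=
  Subtype.ext (by rw [coe_flow, zero_smul, NormedSpace.exp_zero, OneMemClass.coe_one])

theorem flow_add (a b c s t : ℝ) : flow a b c (s + t) = flow a b c s * flow a b c t := by
  apply Subtype.ext
  rw [Submonoid.coe_mul, coe_flow, coe_flow, coe_flow, add_smul]
  exact Matrix.exp_add_of_commute _ _ (((Commute.refl _).smul_left s).smul_right t)

/-- `f'` is the image of the vector-valued function `f` under the left-invariant vector field
`a X + b Y + c Z`. Unlike `vectorField`, this asserts that the derivatives exist. -/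
def HasVectorField (a b c : ℝ) (f f' : SU2 → E) : Prop :=
  ∀ g, HasDerivAt (fun s => f (g * flow a b c s)) (f' g) 0

namespace HasVectorField

variable {f f' f₁ f₁' : SU2 → E}

theorem add (hf : HasVectorField a b c f f') (hf₁ : HasVectorField a b c f₁ f₁') :
    HasVectorField a b c (f + f₁) (f' + f₁') := fun g => (hf g).add (hf₁ g)

theorem const_smul (k : ℂ) {f f' : SU2 → ℂ} (hf : HasVectorField a b c f f') :
    HasVectorField a b c (k • f) (k • f') := fun g => (hf g).const_smul k

theorem clm_comp {E' : Type*} [NormedAddCommGroup E'] [NormedSpace ℝ E'] (T : E →L[ℝ] E')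
    (hf : HasVectorField a b c f f') : HasVectorField a b c (fun g => T (f g)) fun g => T (f' g) :=
  fun g => T.hasFDerivAt.comp_hasDerivAt 0 (hf g)

theorem conj_comp {f f' : SU2 → ℂ} (hf : HasVectorField a b c f f') :
    HasVectorField a b c (fun g => conj (f g)) fun g => conj (f' g) :=
  hf.clm_comp Complex.conjCLE.toContinuousLinearMap

theorem vectorField_eq {f f' : SU2 → ℝ} (hf : HasVectorField a b c f f') :
    vectorField a b c f = f' := funext fun g => (hf g).deriv

theorem hasDerivAt (hf : HasVectorField a b c f f') (g : SU2) (s : ℝ) :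
    HasDerivAt (fun s => f (g * flow a b c s)) (f' (g * flow a b c s)) s := by
  have h₀ : HasDerivAt (fun t => f (g * flow a b c s * flow a b c t)) (f' (g * flow a b c s))
      (s - s) := by
    rw [sub_self]
    exact hf _
  have h := h₀.comp_sub_const s s
  simpa only [mul_assoc, ← flow_add, add_sub_cancel] using h

end HasVectorField

end Flow

section Smooth

variable {a b c : ℝ}

/-- The entries of a group element, as a point of the space on which `IsSmooth` extends
functions. -/
def entries (g : SU2) : Fin 2 → Fin 2 → ℂ := fun i j => (g : Matrix (Fin 2) (Fin 2) ℂ) i j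

theorem continuous_entries : Continuous entries :=
  continuous_pi fun i => continuous_pi fun j =>
    (continuous_apply_apply i j).comp continuous_subtype_val

theorem entries_mul (g h : SU2) (i j : Fin 2) :
    entries (g * h) i j = ∑ k, entries g i k * entries h k j := rfl

theorem hasVectorField_entries (a b c : ℝ) :
    HasVectorField a b c entries fun g i j => ∑ k, entries g i k * su2Mat a b c k j := by
  refine fun g => hasDerivAt_pi.2 fun i => hasDerivAt_pi.2 fun j => ?_
  have hexp (k : Fin 2) :
      HasDerivAt (fun s => entries (flow a b c s) k j) (su2Mat a b c k j) 0 := by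
    simp only [entries, coe_flow]
    exact hasDerivAt_matrix_exp_smul_apply _ k j
  simp only [entries_mul]
  exact HasDerivAt.fun_sum fun k _ => (hexp k).const_mul (entries g i k)

theorem hasVectorField_extension {F : (Fin 2 → Fin 2 → ℂ) → ℝ} (hF : ContDiff ℝ ∞ F) (a b c : ℝ) :
    HasVectorField a b c (fun g => F (entries g)) fun g =>
      fderiv ℝ F (entries g) fun i j => ∑ k, entries g i k * su2Mat a b c k j := by
  intro g
  have hF' := (hF.differentiable (by simp) (entries (g * flow a b c 0))).hasFDerivAt
  have h := hF'.comp_hasDerivAt 0 (hasVectorField_entries a b c g)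
  rwa [flow_zero, mul_one] at h

namespace IsSmooth

variable {f f₁ f₂ : SU2 → ℝ}

theorem hasVectorField (hf : IsSmooth f) (a b c : ℝ) :
    HasVectorField a b c f (vectorField a b c f) := by
  obtain ⟨F, hF, hfF⟩ := hf
  obtain rfl : f = fun g => F (entries g) := funext hfF
  exact fun g => (hasVectorField_extension hF a b c g).differentiableAt.hasDerivAt

theorem vectorField (hf : IsSmooth f) (a b c : ℝ) : IsSmooth (vectorField a b c f) := by
  obtain ⟨F, hF, hfF⟩ := hf
  obtain rfl : f = fun g => F (entries g) := funext hfF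
  refine ⟨fun M => fderiv ℝ F M fun i j => ∑ k, M i k * su2Mat a b c k j, ?_,
    congrFun (hasVectorField_extension hF a b c).vectorField_eq⟩
  exact (hF.fderiv_right (by simp)).clm_apply (by fun_prop)

theorem add (h₁ : IsSmooth f₁) (h₂ : IsSmooth f₂) : IsSmooth (f₁ + f₂) := by
  obtain ⟨F, hF, hf₁⟩ := h₁
  obtain ⟨G, hG, hf₂⟩ := h₂
  exact ⟨F + G, hF.add hG, fun g => by simp [hf₁, hf₂]⟩

theorem mul (h₁ : IsSmooth f₁) (h₂ : IsSmooth f₂) : IsSmooth (f₁ * f₂) := by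
  obtain ⟨F, hF, hf₁⟩ := h₁
  obtain ⟨G, hG, hf₂⟩ := h₂
  exact ⟨F * G, hF.mul hG, fun g => by simp [hf₁, hf₂]⟩

theorem const (k : ℝ) : IsSmooth fun _ => k := ⟨fun _ => k, contDiff_const, fun _ => rfl⟩

theorem const_smul (k : ℝ) (hf : IsSmooth f) : IsSmooth (k • f) := (const k).mul hf

theorem continuous (hf : IsSmooth f) : Continuous f := by
  obtain ⟨F, hF, hfF⟩ := hf
  obtain rfl : f = fun g => F (entries g) := funext hfF
  exact hF.continuous.comp continuous_entries

theorem comp_mul_left (hf : IsSmooth f) (h : SU2) : IsSmooth fun g => f (h * g) := by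
  obtain ⟨F, hF, hfF⟩ := hf
  exact ⟨fun M => F fun i j => ∑ k, entries h i k * M k j, hF.comp (by fun_prop),
    fun g => hfF (h * g)⟩

theorem vectorField_add (h₁ : IsSmooth f₁) (h₂ : IsSmooth f₂) (a b c : ℝ) :
    SU2.vectorField a b c (f₁ + f₂) = SU2.vectorField a b c f₁ + SU2.vectorField a b c f₂ :=
  ((h₁.hasVectorField a b c).add (h₂.hasVectorField a b c)).vectorField_eq

theorem vectorField_mul (h₁ : IsSmooth f₁) (h₂ : IsSmooth f₂) (a b c : ℝ) :
    SU2.vectorField a b c (f₁ * f₂) =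
      SU2.vectorField a b c f₁ * f₂ + f₁ * SU2.vectorField a b c f₂ := by
  ext g
  have h := ((h₁.hasVectorField a b c g).fun_mul (h₂.hasVectorField a b c g)).deriv
  simp only [flow_zero, mul_one] at h
  exact h

end IsSmooth

theorem vectorField_const_smul (k : ℝ) (f : SU2 → ℝ) (a b c : ℝ) :
    vectorField a b c (k • f) = k • vectorField a b c f :=
  funext fun _ => deriv_const_mul_field k

theorem vectorField_comp_mul_left (f : SU2 → ℝ) (h : SU2) (a b c : ℝ) :
    vectorField a b c (fun g => f (h * g)) = fun g => vectorField a b c f (h * g) := by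
  simp only [vectorField, mul_assoc]
  rfl

theorem sublaplacian_eq (f : SU2 → ℝ) : sublaplacian f =
    vectorField 1 0 0 (vectorField 1 0 0 f) + vectorField 0 1 0 (vectorField 0 1 0 f) := rfl

theorem sublaplacian_const_smul (k : ℝ) (f : SU2 → ℝ) :
    sublaplacian (k • f) = k • sublaplacian f := by
  simp only [sublaplacian_eq, vectorField_const_smul, smul_add]

theorem sublaplacian_comp_mul_left (f : SU2 → ℝ) (h : SU2) :
    sublaplacian (fun g => f (h * g)) = fun g => sublaplacian f (h * g) := by
  ext g
  simp only [sublaplacian, vectorField_comp_mul_left]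

namespace IsSmooth

variable {f f₁ f₂ : SU2 → ℝ}

theorem sublaplacian (hf : IsSmooth f) : IsSmooth (sublaplacian f) :=
  ((hf.vectorField 1 0 0).vectorField 1 0 0).add ((hf.vectorField 0 1 0).vectorField 0 1 0)

theorem sublaplacian_add (h₁ : IsSmooth f₁) (h₂ : IsSmooth f₂) :
    SU2.sublaplacian (f₁ + f₂) = SU2.sublaplacian f₁ + SU2.sublaplacian f₂ := by
  have h (a b c : ℝ) : SU2.vectorField a b c (SU2.vectorField a b c (f₁ + f₂)) =
      SU2.vectorField a b c (SU2.vectorField a b c f₁) +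
        SU2.vectorField a b c (SU2.vectorField a b c f₂) := by
    rw [h₁.vectorField_add h₂, (h₁.vectorField a b c).vectorField_add (h₂.vectorField a b c)]
  rw [sublaplacian_eq, h, h, add_add_add_comm, ← sublaplacian_eq, ← sublaplacian_eq]

end IsSmooth

end Smooth

section Haar

instance instIsHaarMeasureHaar : haar.IsHaarMeasure :=
  inferInstanceAs (Measure.haarMeasure ⊤).IsHaarMeasure

instance instIsProbabilityMeasureHaar : IsProbabilityMeasure haar :=
  ⟨Measure.haarMeasure_self (K₀ := (⊤ : TopologicalSpace.PositiveCompacts SU2))⟩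

instance instRegularHaar : haar.Regular := inferInstanceAs (Measure.haarMeasure ⊤).Regular

instance instIsMulRightInvariantHaar : haar.IsMulRightInvariant where
  map_mul_right_eq_self g := by
    have : IsProbabilityMeasure (haar.map (· * g)) :=
      Measure.isProbabilityMeasure_map (measurable_mul_const g).aemeasurable
    exact Measure.isHaarMeasure_eq_of_isProbabilityMeasure _ _

variable {E : Type*} [NormedAddCommGroup E]

theorem integrable_of_continuous {f : SU2 → E} (hf : Continuous f) : Integrable f haar :=
  hf.integrable_of_hasCompactSupport (.of_compactSpace f)

theorem exists_norm_le_of_continuous {f : SU2 → E} (hf : Continuous f) : ∃ C, ∀ g, ‖f g‖ ≤ C :=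
  let ⟨_, hg⟩ := hf.norm.exists_forall_ge_of_hasCompactSupport (.of_compactSpace _)
  ⟨_, hg⟩

theorem HasVectorField.integral_eq_zero [NormedSpace ℝ E] {a b c : ℝ} {f f' : SU2 → E}
    (hd : HasVectorField a b c f f') (hf : Continuous f) (hf' : Continuous f') :
    ∫ g, f' g ∂haar = 0 := by
  obtain ⟨C, hC⟩ := exists_norm_le_of_continuous hf'
  have htranslate {u : SU2 → E} (hu : Continuous u) (s : ℝ) :
      Integrable (fun g => u (g * flow a b c s)) haar :=
    integrable_of_continuous (hu.comp (continuous_mul_const _))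
  have h := (hasDerivAt_integral_of_dominated_loc_of_deriv_le (μ := haar)
    (F := fun s g => f (g * flow a b c s)) (F' := fun s g => f' (g * flow a b c s)) (x₀ := (0 : ℝ))
    (bound := fun _ => C) Filter.univ_mem
    (.of_forall fun s => (htranslate hf s).aestronglyMeasurable) (htranslate hf 0)
    (htranslate hf' 0).aestronglyMeasurable (.of_forall fun _ _ _ => hC _) (integrable_const C)
    (.of_forall fun g s _ => hd.hasDerivAt g s)).2
  -- by right invariance the differentiated integral does not depend on `s`
  simp only [integral_mul_right_eq_self] at h
  exact h.unique (hasDerivAt_const 0 _)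

namespace IsSmooth

variable {f f₁ f₂ : SU2 → ℝ}

theorem integrable_mul (h₁ : IsSmooth f₁) (h₂ : IsSmooth f₂) :
    Integrable (fun g => f₁ g * f₂ g) haar :=
  integrable_of_continuous (h₁.mul h₂).continuous

theorem integral_vectorField_mul (h₁ : IsSmooth f₁) (h₂ : IsSmooth f₂) (a b c : ℝ) :
    ∫ g, SU2.vectorField a b c f₁ g * f₂ g ∂haar =
      -∫ g, f₁ g * SU2.vectorField a b c f₂ g ∂haar := by
  have h := ((h₁.mul h₂).hasVectorField a b c).integral_eq_zero (h₁.mul h₂).continuous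
    ((h₁.mul h₂).vectorField a b c).continuous
  simp only [h₁.vectorField_mul h₂, Pi.add_apply, Pi.mul_apply] at h
  rw [integral_add ((h₁.vectorField a b c).integrable_mul h₂)
    (h₁.integrable_mul (h₂.vectorField a b c))] at h
  exact eq_neg_of_add_eq_zero_left h

theorem integral_sublaplacian_mul (h₁ : IsSmooth f₁) (h₂ : IsSmooth f₂) :
    ∫ g, SU2.sublaplacian f₁ g * f₂ g ∂haar = ∫ g, f₁ g * SU2.sublaplacian f₂ g ∂haar := by
  have hX₁ (a b c : ℝ) := (h₁.vectorField a b c).vectorField a b c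
  have hX₂ (a b c : ℝ) := (h₂.vectorField a b c).vectorField a b c
  have hsymm (a b c : ℝ) :
      ∫ g, SU2.vectorField a b c (SU2.vectorField a b c f₁) g * f₂ g ∂haar =
        ∫ g, f₁ g * SU2.vectorField a b c (SU2.vectorField a b c f₂) g ∂haar := by
    rw [(h₁.vectorField a b c).integral_vectorField_mul h₂,
      h₁.integral_vectorField_mul (h₂.vectorField a b c), neg_neg]
  simp only [sublaplacian_eq, Pi.add_apply, add_mul, mul_add]
  rw [integral_add ((hX₁ 1 0 0).integrable_mul h₂) ((hX₁ 0 1 0).integrable_mul h₂),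
    integral_add (h₁.integrable_mul (hX₂ 1 0 0)) (h₁.integrable_mul (hX₂ 0 1 0)), hsymm, hsymm]

end IsSmooth

end Haar

section MaximumPrinciple

theorem IsSmooth.vectorField_vectorField_nonpos {f : SU2 → ℝ} (hf : IsSmooth f) {g : SU2}
    (hg : ∀ h, f h ≤ f g) (a b c : ℝ) : SU2.vectorField a b c (SU2.vectorField a b c f) g ≤ 0 := by
  have hd := (hf.hasVectorField a b c).hasDerivAt g
  have hmax : IsLocalMax (fun s => f (g * flow a b c s)) 0 :=
    .of_forall fun s => by simpa only [flow_zero, mul_one] using hg _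
  have h := deriv_deriv_nonpos_of_isLocalMax hmax (hd 0).continuousAt
  rwa [deriv_eq hd] at h

theorem IsSmooth.sublaplacian_nonpos {f : SU2 → ℝ} (hf : IsSmooth f) {g : SU2}
    (hg : ∀ h, f h ≤ f g) : SU2.sublaplacian f g ≤ 0 :=
  add_nonpos (hf.vectorField_vectorField_nonpos hg 1 0 0)
    (hf.vectorField_vectorField_nonpos hg 0 1 0)

end MaximumPrinciple

section Monomial

/-- The monomial `α ^ p * conj α ^ q * β ^ r * conj β ^ s` in the matrix entries. -/
noncomputable def monomial (p q r s : ℕ) (g : SU2) : ℂ :=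
  α g ^ p * conj (α g) ^ q * β g ^ r * conj (β g) ^ s

theorem continuous_monomial (p q r s : ℕ) : Continuous (monomial p q r s) := by
  have hα := continuous_α
  have hβ := continuous_β
  unfold monomial
  fun_prop

theorem conj_monomial (p q r s : ℕ) (g : SU2) :
    conj (monomial p q r s g) = monomial q p s r g := by
  simp only [monomial, map_mul, map_pow, Complex.conj_conj]
  ring

theorem monomial_mul (p q r s p' q' r' s' : ℕ) (g : SU2) :
    monomial p q r s g * monomial p' q' r' s' g =
      monomial (p + p') (q + q') (r + r') (s + s') g := by
  simp only [monomial]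
  ring

theorem monomial_succ_add (p q r s : ℕ) (g : SU2) :
    monomial (p + 1) (q + 1) r s g + monomial p q (r + 1) (s + 1) g = monomial p q r s g := by
  simp only [monomial]
  linear_combination (α g ^ p * conj (α g) ^ q * β g ^ r * conj (β g) ^ s) * α_mul_conj_add g

theorem isSmooth_re_monomial (k : ℂ) (p q r s : ℕ) :
    IsSmooth fun g => (k * monomial p q r s g).re := by
  have hconj (j : Fin 2) : ContDiff ℝ ∞ fun M : Fin 2 → Fin 2 → ℂ => conj (M 0 j) :=
    Complex.conjCLE.contDiff.comp (by fun_prop)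
  have hF : ContDiff ℝ ∞ fun M : Fin 2 → Fin 2 → ℂ =>
      k * (M 0 0 ^ p * conj (M 0 0) ^ q * M 0 1 ^ r * conj (M 0 1) ^ s) := by fun_prop
  exact ⟨_, Complex.reCLM.contDiff.comp hF, fun g => rfl⟩

theorem hasVectorField_α (a b c : ℝ) : HasVectorField a b c α fun g =>
    Complex.I * c * α g - conj (a + Complex.I * b : ℂ) * β g := by
  intro g
  refine (hasDerivAt_pi.1 (hasDerivAt_pi.1 (hasVectorField_entries a b c g) 0) 0).congr_deriv ?_
  simp [Fin.sum_univ_two, su2Mat_eq, entries, α, β]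
  ring

theorem hasVectorField_β (a b c : ℝ) : HasVectorField a b c β fun g =>
    (a + Complex.I * b : ℂ) * α g - Complex.I * c * β g := by
  intro g
  refine (hasDerivAt_pi.1 (hasDerivAt_pi.1 (hasVectorField_entries a b c g) 0) 1).congr_deriv ?_
  simp [Fin.sum_univ_two, su2Mat_eq, entries, α, β]
  ring

/-- The image of a monomial under the lowering operator, the derivation
`β ∂/∂α - conj α ∂/∂(conj β)`. The exponents are truncated only where the coefficient vanishes. -/
noncomputable def lowering (p q r s : ℕ) : SU2 → ℂ :=
  (p : ℂ) • monomial (p - 1) q (r + 1) s + (-(s : ℂ)) • monomial p (q + 1) r (s - 1)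

/-- The image of a monomial under the raising operator, the derivation
`α ∂/∂β - conj β ∂/∂(conj α)`. The exponents are truncated only where the coefficient vanishes. -/
noncomputable def raising (p q r s : ℕ) : SU2 → ℂ :=
  (r : ℂ) • monomial (p + 1) q (r - 1) s + (-(q : ℂ)) • monomial p (q - 1) r (s + 1)

theorem hasVectorField_monomial (a b : ℝ) (p q r s : ℕ) :
    HasVectorField a b 0 (monomial p q r s) ((-conj (a + Complex.I * b : ℂ)) • lowering p q r s +
      (a + Complex.I * b : ℂ) • raising p q r s) := by
  intro g
  have hα := hasVectorField_α a b 0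
  have hβ := hasVectorField_β a b 0
  have h := ((((hα g).fun_pow p).fun_mul ((hα.conj_comp g).fun_pow q)).fun_mul
    ((hβ g).fun_pow r)).fun_mul ((hβ.conj_comp g).fun_pow s)
  refine h.congr_deriv ?_
  simp only [flow_zero, mul_one, lowering, raising, monomial, Pi.add_apply, Pi.smul_apply,
    smul_eq_mul, map_sub, map_mul, Complex.conj_conj, Complex.ofReal_zero, map_zero]
  ring

/-- `f'` is the image of the complex-valued function `f` under the sublaplacian. -/
def HasSublaplacian (f f' : SU2 → ℂ) : Prop :=
  ∃ fX fXX fY fYY, HasVectorField 1 0 0 f fX ∧ HasVectorField 1 0 0 fX fXX ∧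
    HasVectorField 0 1 0 f fY ∧ HasVectorField 0 1 0 fY fYY ∧ f' = fXX + fYY

namespace HasSublaplacian

variable {f f' f₁ f₁' : SU2 → ℂ}

theorem zero : HasSublaplacian 0 0 :=
  have h (a b : ℝ) : HasVectorField a b 0 (0 : SU2 → ℂ) 0 := fun _ => hasDerivAt_const _ _
  ⟨0, 0, 0, 0, h 1 0, h 1 0, h 0 1, h 0 1, (add_zero 0).symm⟩

theorem add (hf : HasSublaplacian f f') (hf₁ : HasSublaplacian f₁ f₁') :
    HasSublaplacian (f + f₁) (f' + f₁') := by
  obtain ⟨fX, fXX, fY, fYY, hX, hXX, hY, hYY, rfl⟩ := hf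
  obtain ⟨fX₁, fXX₁, fY₁, fYY₁, hX₁, hXX₁, hY₁, hYY₁, rfl⟩ := hf₁
  exact ⟨_, _, _, _, hX.add hX₁, hXX.add hXX₁, hY.add hY₁, hYY.add hYY₁, add_add_add_comm _ _ _ _⟩

theorem const_smul (k : ℂ) (hf : HasSublaplacian f f') : HasSublaplacian (k • f) (k • f') := by
  obtain ⟨fX, fXX, fY, fYY, hX, hXX, hY, hYY, rfl⟩ := hf
  exact ⟨_, _, _, _, hX.const_smul k, hXX.const_smul k, hY.const_smul k, hYY.const_smul k,
    smul_add _ _ _⟩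

theorem sum {ι : Type*} (t : Finset ι) {f f' : ι → SU2 → ℂ}
    (h : ∀ i ∈ t, HasSublaplacian (f i) (f' i)) :
    HasSublaplacian (∑ i ∈ t, f i) (∑ i ∈ t, f' i) := by
  classical
  induction t using Finset.induction_on with
  | empty => exact zero
  | insert a t ha ih =>
    rw [Finset.sum_insert ha, Finset.sum_insert ha]
    rw [Finset.forall_mem_insert] at h
    exact h.1.add (ih h.2)

theorem sublaplacian_re (hf : HasSublaplacian f f') :
    sublaplacian (fun g => (f g).re) = fun g => (f' g).re := by
  obtain ⟨fX, fXX, fY, fYY, hX, hXX, hY, hYY, rfl⟩ := hf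
  have hre {a b c : ℝ} {f f' : SU2 → ℂ} (h : HasVectorField a b c f f') :
      vectorField a b c (fun g => (f g).re) = fun g => (f' g).re :=
    (h.clm_comp Complex.reCLM).vectorField_eq
  rw [sublaplacian_eq, hre hX, hre hXX, hre hY, hre hYY]
  rfl

end HasSublaplacian

theorem hasSublaplacian_monomial (p q r s : ℕ) : HasSublaplacian (monomial p q r s)
    ((-2 * (r * (p + 1) + q * (s + 1) + p * (r + 1) + s * (q + 1)) : ℂ) • monomial p q r s +
      ((4 * r * s : ℂ) • monomial (p + 1) (q + 1) (r - 1) (s - 1) +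
      (4 * p * q : ℂ) • monomial (p - 1) (q - 1) (r + 1) (s + 1))) := by
  have hcomb (a b : ℝ) (k l : ℂ) (i j m n i' j' m' n' : ℕ) :=
    ((hasVectorField_monomial a b i j m n).const_smul k).add
      ((hasVectorField_monomial a b i' j' m' n').const_smul l)
  refine ⟨_, _, _, _, hasVectorField_monomial 1 0 p q r s,
    ((hcomb 1 0 _ _ _ _ _ _ _ _ _ _).const_smul _).add
      ((hcomb 1 0 _ _ _ _ _ _ _ _ _ _).const_smul _),
    hasVectorField_monomial 0 1 p q r s,
    ((hcomb 0 1 _ _ _ _ _ _ _ _ _ _).const_smul _).add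
      ((hcomb 0 1 _ _ _ _ _ _ _ _ _ _).const_smul _), ?_⟩
  ext g
  rcases p with _ | p <;> rcases q with _ | q <;> rcases r with _ | r <;> rcases s with _ | s <;>
    simp [lowering, raising] <;> ring_nf <;> (try simp only [Complex.I_sq]) <;> (try ring)

end Monomial

section Orthogonality

theorem monomial_exp_vertical_mul (p q r s : ℕ) (z : ℝ) (g : SU2) :
    monomial p q r s (SU2.exp 0 0 z * g) =
      Complex.exp (((p - q + r - s : ℤ) : ℂ) * (Complex.I * z)) * monomial p q r s g := by
  simp only [monomial, α_mul, β_mul, α_exp_vertical, β_exp_vertical, map_mul, zero_mul,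
    sub_zero, add_zero, Complex.exp_int_mul, ← Complex.exp_conj, Complex.conj_I,
    Complex.conj_ofReal, neg_mul, Complex.exp_neg, zpow_sub₀ (Complex.exp_ne_zero _),
    zpow_add₀ (Complex.exp_ne_zero _),
    zpow_natCast, mul_pow, inv_pow, div_eq_mul_inv]
  ring

theorem monomial_mul_exp_vertical (p q r s : ℕ) (z : ℝ) (g : SU2) :
    monomial p q r s (g * SU2.exp 0 0 z) =
      Complex.exp (((p - q - r + s : ℤ) : ℂ) * (Complex.I * z)) * monomial p q r s g := by
  simp only [monomial, α_mul, β_mul, α_exp_vertical, β_exp_vertical, map_mul, map_zero,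
    mul_zero, sub_zero, zero_add, Complex.exp_int_mul, ← Complex.exp_conj, Complex.conj_I,
    Complex.conj_ofReal, neg_mul, Complex.exp_neg, map_inv₀, inv_inv,
    zpow_sub₀ (Complex.exp_ne_zero _), zpow_add₀ (Complex.exp_ne_zero _), zpow_natCast, mul_pow,
    inv_pow, div_eq_mul_inv]
  ring

theorem exp_int_mul_I_mul_pi_div {N : ℤ} (hN : N ≠ 0) :
    Complex.exp ((N : ℂ) * (Complex.I * (Real.pi / N : ℝ))) = -1 := by
  have hN' : (N : ℂ) ≠ 0 := Int.cast_ne_zero.2 hN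
  rw [← Complex.exp_pi_mul_I]
  congr 1
  push_cast
  field_simp

theorem integral_monomial_eq_zero {p q r s : ℕ} (h : p ≠ q ∨ r ≠ s) :
    ∫ g, monomial p q r s g ∂haar = 0 := by
  by_cases hl : (p - q + r - s : ℤ) = 0
  · have hr : (p - q - r + s : ℤ) ≠ 0 := by omega
    refine integral_eq_zero_of_mul_right_eq_neg
      (g := SU2.exp 0 0 (Real.pi / (p - q - r + s : ℤ))) fun g => ?_
    rw [monomial_mul_exp_vertical, exp_int_mul_I_mul_pi_div hr, neg_one_mul]
  · refine integral_eq_zero_of_mul_left_eq_neg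
      (g := SU2.exp 0 0 (Real.pi / (p - q + r - s : ℤ))) fun g => ?_
    rw [monomial_exp_vertical_mul, exp_int_mul_I_mul_pi_div hl, neg_one_mul]

theorem integrable_monomial (p q r s : ℕ) : Integrable (monomial p q r s) haar :=
  integrable_of_continuous (continuous_monomial p q r s)

theorem integral_monomial_succ_add (p q r s : ℕ) :
    ∫ g, monomial (p + 1) (q + 1) r s g ∂haar + ∫ g, monomial p q (r + 1) (s + 1) g ∂haar =
      ∫ g, monomial p q r s g ∂haar := by
  rw [← integral_add (integrable_monomial _ _ _ _) (integrable_monomial _ _ _ _)]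
  simp only [monomial_succ_add]

theorem integral_lowering_eq_zero (p q r s : ℕ) : ∫ g, lowering p q r s g ∂haar = 0 := by
  have hlow : Continuous (lowering p q r s) :=
    ((continuous_monomial _ _ _ _).const_smul _).add ((continuous_monomial _ _ _ _).const_smul _)
  have hrais : Continuous (raising p q r s) :=
    ((continuous_monomial _ _ _ _).const_smul _).add ((continuous_monomial _ _ _ _).const_smul _)
  have hint (a b : ℝ) : -conj (a + Complex.I * b : ℂ) * ∫ g, lowering p q r s g ∂haar +
      (a + Complex.I * b : ℂ) * ∫ g, raising p q r s g ∂haar = 0 := by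
    rw [← integral_const_mul, ← integral_const_mul,
      ← integral_add ((integrable_of_continuous hlow).const_mul _)
        ((integrable_of_continuous hrais).const_mul _)]
    exact (hasVectorField_monomial a b p q r s).integral_eq_zero (continuous_monomial p q r s)
      ((hlow.const_smul _).add (hrais.const_smul _))
  have hX := hint 1 0
  have hY := hint 0 1
  simp only [Complex.ofReal_zero, Complex.ofReal_one, mul_one, mul_zero, zero_add, add_zero,
    map_one, Complex.conj_I, neg_neg] at hX hY
  linear_combination -(1 / 2) * hX - (Complex.I / 2) * hY +
    ((∫ g, lowering p q r s g ∂haar) + ∫ g, raising p q r s g ∂haar) / 2 * Complex.I_sq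

theorem integral_monomial_recurrence (i s : ℕ) :
    ((s : ℂ) + 1) * ∫ g, monomial (i + 1) (i + 1) s s g ∂haar =
      ((i : ℂ) + 1) * ∫ g, monomial i i (s + 1) (s + 1) g ∂haar := by
  have h := integral_lowering_eq_zero (i + 1) i s (s + 1)
  have hI := integrable_monomial
  rw [lowering, integral_add' ((hI _ _ _ _).smul _) ((hI _ _ _ _).smul _)] at h
  simp only [Pi.smul_apply, smul_eq_mul, integral_const_mul, add_tsub_cancel_right] at h
  push_cast at h
  linear_combination -h

theorem integral_monomial_diag (i s : ℕ) : ∫ g, monomial i i s s g ∂haar =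
    (i.factorial * s.factorial : ℂ) / ((i + s + 1).factorial : ℂ) := by
  have hleft (i s : ℕ) : ((i + s + 2 : ℕ) : ℂ) * ∫ g, monomial (i + 1) (i + 1) s s g ∂haar =
      (i + 1) * ∫ g, monomial i i s s g ∂haar := by
    push_cast
    linear_combination integral_monomial_recurrence i s +
      (i + 1 : ℂ) * integral_monomial_succ_add i i s s
  have hright (i s : ℕ) : ((i + s + 2 : ℕ) : ℂ) * ∫ g, monomial i i (s + 1) (s + 1) g ∂haar =
      (s + 1) * ∫ g, monomial i i s s g ∂haar := by
    push_cast
    linear_combination -integral_monomial_recurrence i s +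
      (s + 1 : ℂ) * integral_monomial_succ_add i i s s
  rw [eq_div_iff (Nat.cast_ne_zero.2 (Nat.factorial_ne_zero _)), mul_comm]
  induction s with
  | zero =>
    induction i with
    | zero => simp [monomial]
    | succ i ih =>
      have h := hleft i 0
      simp only [add_zero] at h ih ⊢
      rw [Nat.factorial_succ (i + 1), Nat.factorial_succ i]
      rw [Nat.factorial_succ i] at ih
      push_cast at h ih ⊢
      linear_combination ((i + 1) * i.factorial : ℂ) * h + (i + 1 : ℂ) * ih
  | succ s ih =>
    have h := hright i s
    rw [← add_assoc i s 1, Nat.factorial_succ (i + s + 1), Nat.factorial_succ s]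
    push_cast at h ih ⊢
    linear_combination ((i + s + 1).factorial : ℂ) * h + (s + 1 : ℂ) * ih

end Orthogonality

section ZonalCoefficients

/-- The coefficients of the zonal functions on monomials. -/
def zonalCoeff (n k s : ℕ) : ℤ := (-1) ^ s * (n + k).choose s * k.choose s

/-- The zonal function of weight `n ≥ 0` in the irreducible representation of dimension
`2 k + n + 1`: the normalized matrix coefficient of the vector `α ^ (n + k) * β ^ k`. -/
noncomputable def zonalNat (n k : ℕ) (g : SU2) : ℂ :=
  ∑ s ∈ Finset.range (k + 1), zonalCoeff n k s * monomial (n + k - s) (k - s) s s g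

/-- The eigenvalue of minus the sublaplacian on `zonalNat n k`. -/
noncomputable def eigenvalue (n k : ℕ) : ℝ := 4 * k * (k + n + 1) + 2 * n

theorem zonalCoeff_succ {n k s : ℕ} (hs : s ≤ k) : (zonalCoeff n k (s + 1) : ℂ) * (s + 1) ^ 2 =
    -(((n : ℂ) + k - s) * ((k : ℂ) - s) * zonalCoeff n k s) := by
  have hchoose {m : ℕ} (hm : s ≤ m) :
      (m.choose (s + 1) : ℂ) * (s + 1) = m.choose s * (m - s) := by
    rw [← Nat.cast_sub hm]
    exact_mod_cast Nat.choose_succ_right_eq m s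
  have hnk := hchoose (hs.trans (Nat.le_add_left k n))
  simp only [zonalCoeff, pow_succ]
  push_cast at hnk ⊢
  linear_combination (-(-1) ^ s * (k.choose (s + 1) : ℂ) * (s + 1)) * hnk -
    ((-1) ^ s * ((n + k).choose s : ℂ) * (n + k - s)) * hchoose hs

theorem sum_zonalCoeff_recurrence (n k : ℕ) (m : ℕ → ℂ) :
    ∑ s ∈ Finset.range (k + 1), (zonalCoeff n k s : ℂ) *
      (-2 * (2 * s * (n + k - s + (k - s)) + 2 * s + (n + k - s) + (k - s)) * m s +
        (4 * s * s * m (s - 1) + 4 * (n + k - s) * (k - s) * m (s + 1))) =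
    -(eigenvalue n k) * ∑ s ∈ Finset.range (k + 1), (zonalCoeff n k s : ℂ) * m s := by
  have hdown : ∑ s ∈ Finset.range (k + 1), (zonalCoeff n k s : ℂ) * (4 * s * s * m (s - 1)) =
      ∑ s ∈ Finset.range (k + 1), (zonalCoeff n k s : ℂ) * (-4 * (n + k - s) * (k - s) * m s) := by
    rw [Finset.sum_range_succ', Finset.sum_range_succ]
    simp only [Nat.cast_zero, mul_zero, zero_mul, add_zero, sub_self]
    refine Finset.sum_congr rfl fun s hs => ?_
    simp only [Nat.add_sub_cancel]
    push_cast
    linear_combination 4 * m s * zonalCoeff_succ (n := n) (Finset.mem_range.1 hs).le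
  have hup : ∑ s ∈ Finset.range (k + 1), (zonalCoeff n k s : ℂ) *
        (4 * (n + k - s) * (k - s) * m (s + 1)) =
      ∑ s ∈ Finset.range (k + 1), (zonalCoeff n k s : ℂ) * (-4 * s * s * m s) := by
    rw [Finset.sum_range_succ, Finset.sum_range_succ']
    simp only [Nat.cast_zero, mul_zero, zero_mul, add_zero, sub_self]
    refine Finset.sum_congr rfl fun s hs => ?_
    push_cast
    linear_combination 4 * m (s + 1) * zonalCoeff_succ (n := n) (Finset.mem_range.1 hs).le
  simp only [mul_add, Finset.sum_add_distrib] at hdown hup ⊢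
  rw [hdown, hup, Finset.mul_sum]
  simp only [← Finset.sum_add_distrib]
  refine Finset.sum_congr rfl fun s _ => ?_
  simp only [eigenvalue]
  push_cast
  ring

end ZonalCoefficients

section ZonalNat

theorem zonalNat_eq_sum (n k : ℕ) : zonalNat n k =
    ∑ s ∈ Finset.range (k + 1), (zonalCoeff n k s : ℂ) • monomial (n + k - s) (k - s) s s := by
  ext g
  simp [zonalNat]

theorem continuous_zonalNat (n k : ℕ) : Continuous (zonalNat n k) :=
  continuous_finsetSum _ fun _ _ => continuous_const.mul (continuous_monomial _ _ _ _)

theorem hasSublaplacian_zonalNat (n k : ℕ) :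
    HasSublaplacian (zonalNat n k) ((-(eigenvalue n k) : ℂ) • zonalNat n k) := by
  have h := HasSublaplacian.sum (Finset.range (k + 1)) fun s _ =>
    (hasSublaplacian_monomial (n + k - s) (k - s) s s).const_smul (zonalCoeff n k s : ℂ)
  rw [← zonalNat_eq_sum] at h
  convert h using 1
  ext g
  simp only [Pi.smul_apply, smul_eq_mul, zonalNat, Finset.sum_apply, Pi.add_apply]
  rw [← sum_zonalCoeff_recurrence n k fun s => monomial (n + k - s) (k - s) s s g]
  refine Finset.sum_congr rfl fun s hs => ?_
  have hs : s ≤ k := Finset.mem_range_succ_iff.1 hs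
  rw [Nat.cast_sub hs, Nat.cast_sub (hs.trans (Nat.le_add_left k n)), Nat.sub_sub, Nat.sub_sub]
  rcases s with _ | s
  · push_cast
    ring_nf
  · rw [show n + k - (s + 1) + 1 = n + k - (s + 1 - 1) by omega,
      show k - (s + 1) + 1 = k - (s + 1 - 1) by omega]
    push_cast
    ring

theorem monomial_mul_mul_conj (n k : ℕ) (g h : SU2) :
    monomial (n + k) 0 k 0 (h * g) * conj (monomial (n + k) 0 k 0 h) =
      ∑ t ∈ Finset.range (k + 1), ∑ s ∈ Finset.range (n + k + 1),
        ((-1) ^ s * (n + k).choose s * k.choose t * monomial (n + k - s) (k - t) t s g) *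
          monomial (n + k - s + t) (n + k) (s + (k - t)) k h := by
  have hα : α (h * g) ^ (n + k) = ∑ s ∈ Finset.range (n + k + 1),
      (-(β h * conj (β g))) ^ s * (α h * α g) ^ (n + k - s) * (n + k).choose s := by
    rw [← add_pow, α_mul, neg_add_eq_sub]
  have hβ : β (h * g) ^ k = ∑ t ∈ Finset.range (k + 1),
      (α h * β g) ^ t * (β h * conj (α g)) ^ (k - t) * k.choose t := by
    rw [← add_pow, β_mul]
  have hmon : monomial (n + k) 0 k 0 (h * g) = β (h * g) ^ k * α (h * g) ^ (n + k) := by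
    simp only [monomial]
    ring
  rw [conj_monomial, hmon, hα, hβ, Finset.sum_mul_sum, Finset.sum_mul]
  refine Finset.sum_congr rfl fun t _ => ?_
  rw [Finset.sum_mul]
  refine Finset.sum_congr rfl fun s _ => ?_
  rw [neg_pow]
  simp only [monomial, mul_pow, pow_add]
  ring

theorem integral_translate_mul_conj (n k : ℕ) (g : SU2) :
    ∫ h, monomial (n + k) 0 k 0 (h * g) * conj (monomial (n + k) 0 k 0 h) ∂haar =
      (∫ h, monomial (n + k) (n + k) k k h ∂haar) * zonalNat n k g := by
  have hI (c : ℂ) (p q r s : ℕ) := (integrable_monomial p q r s).const_mul c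
  simp only [monomial_mul_mul_conj]
  rw [integral_finsetSum _ fun t _ => integrable_finsetSum _ fun s _ => hI _ _ _ _ _, zonalNat,
    Finset.mul_sum]
  refine Finset.sum_congr rfl fun t ht => ?_
  have ht : t ≤ k := Finset.mem_range_succ_iff.1 ht
  rw [integral_finsetSum _ fun s _ => hI _ _ _ _ _]
  simp only [integral_const_mul]
  rw [Finset.sum_eq_single_of_mem t (Finset.mem_range.2 (by omega))]
  · rw [Nat.sub_add_cancel (ht.trans (Nat.le_add_left k n)), Nat.add_sub_of_le ht, zonalCoeff]
    push_cast
    ring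
  · intro s hs hst
    have hs : s ≤ n + k := Finset.mem_range_succ_iff.1 hs
    rw [integral_monomial_eq_zero (by omega), mul_zero]

theorem norm_integral_translate_mul_conj_le {f : SU2 → ℂ} (hf : Continuous f) (g : SU2) :
    ‖∫ h, f (h * g) * conj (f h) ∂haar‖ ≤ ∫ h, ‖f h‖ ^ 2 ∂haar := by
  calc ‖∫ h, f (h * g) * conj (f h) ∂haar‖
      ≤ ∫ h, (‖f (h * g)‖ ^ 2 + ‖f h‖ ^ 2) / 2 ∂haar := by
        refine norm_integral_le_of_norm_le (integrable_of_continuous (by fun_prop))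
          (.of_forall fun h => ?_)
        rw [norm_mul, RCLike.norm_conj]
        linarith [two_mul_le_add_sq ‖f (h * g)‖ ‖f h‖]
    _ = ∫ h, ‖f h‖ ^ 2 ∂haar := by
        rw [integral_div, integral_add (integrable_of_continuous (by fun_prop))
          (integrable_of_continuous (by fun_prop)),
          integral_mul_right_eq_self (fun h => ‖f h‖ ^ 2) g]
        ring

theorem norm_zonalNat_le_one (n k : ℕ) (g : SU2) : ‖zonalNat n k g‖ ≤ 1 := by
  have hnormSq : ((∫ h, ‖monomial (n + k) 0 k 0 h‖ ^ 2 ∂haar : ℝ) : ℂ) =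
      ∫ h, monomial (n + k) (n + k) k k h ∂haar := by
    rw [← integral_complex_ofReal]
    congr 1 with h
    rw [Complex.ofReal_pow, ← Complex.mul_conj', conj_monomial, monomial_mul]
    simp only [zero_add, add_zero]
  have hpos : 0 < ∫ h, ‖monomial (n + k) 0 k 0 h‖ ^ 2 ∂haar := by
    have hval : ∫ h, ‖monomial (n + k) 0 k 0 h‖ ^ 2 ∂haar =
        ((n + k).factorial * k.factorial : ℝ) / ((n + k + k + 1).factorial : ℝ) :=
      Complex.ofReal_injective (by rw [hnormSq, integral_monomial_diag]; push_cast; rfl)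
    rw [hval]
    positivity
  have hle := norm_integral_translate_mul_conj_le (continuous_monomial (n + k) 0 k 0) g
  rw [integral_translate_mul_conj, ← hnormSq, norm_mul, Complex.norm_real,
    Real.norm_of_nonneg hpos.le] at hle
  exact le_of_mul_le_mul_left (by rwa [mul_one]) hpos

theorem zonalCoeff_mul_integral_monomial_diag (n p s j : ℕ) :
    (zonalCoeff n (s + j) s : ℂ) * ∫ g, monomial (n + p + j) (n + p + j) s s g ∂haar =
      ((-1) ^ s * (s + j).choose s * (n + p + j).choose p : ℤ) *
        (((n + (s + j)).factorial * p.factorial : ℂ) / ((n + p + (s + j) + 1).factorial : ℂ)) := by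
  have h₁ : (((n + (s + j)).choose s * s.factorial * (n + j).factorial : ℕ) : ℂ) =
      (n + (s + j)).factorial := by
    rw [← Nat.choose_mul_factorial_mul_factorial (by omega : s ≤ n + (s + j)),
      show n + (s + j) - s = n + j by omega]
  have h₂ : (((n + p + j).choose p * p.factorial * (n + j).factorial : ℕ) : ℂ) =
      (n + p + j).factorial := by
    rw [← Nat.choose_mul_factorial_mul_factorial (by omega : p ≤ n + p + j),
      show n + p + j - p = n + j by omega]
  rw [integral_monomial_diag, show n + p + j + s + 1 = n + p + (s + j) + 1 by omega, zonalCoeff,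
    ← h₁, ← h₂]
  push_cast
  ring

theorem integral_zonalNat_mul_monomial (n k p : ℕ) :
    ∫ g, zonalNat n k g * monomial p (p + n) 0 0 g ∂haar =
      (p.descFactorial k * (n + p).factorial : ℂ) / ((n + p + k + 1).factorial : ℂ) := by
  have hI (c : ℂ) (p q r s : ℕ) := (integrable_monomial p q r s).const_mul c
  have hterm : ∀ s ∈ Finset.range (k + 1), (zonalCoeff n k s : ℂ) *
      ∫ g, monomial (n + k - s + p) (k - s + (p + n)) (s + 0) (s + 0) g ∂haar =
      ((-1) ^ s * (k.choose s) * ((n + p + (k - s)).choose p) : ℤ) *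
        (((n + k).factorial * p.factorial : ℂ) / ((n + p + k + 1).factorial : ℂ)) := by
    intro s hs
    obtain ⟨j, rfl⟩ := Nat.exists_eq_add_of_le (Finset.mem_range_succ_iff.1 hs)
    rw [add_zero, show n + (s + j) - s + p = n + p + j by omega, Nat.add_sub_cancel_left,
      show j + (p + n) = n + p + j by omega, zonalCoeff_mul_integral_monomial_diag]
  simp only [zonalNat, Finset.sum_mul, mul_assoc, monomial_mul]
  rw [integral_finsetSum _ fun s _ => hI _ _ _ _ _]
  simp only [integral_const_mul]
  rw [Finset.sum_congr rfl hterm, ← Finset.sum_mul, ← Int.cast_sum, alternating_sum_choose]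
  split_ifs with hk
  · obtain ⟨j, rfl⟩ := Nat.exists_eq_add_of_le hk
    have h₁ := Nat.choose_mul_factorial_mul_factorial (by omega : j ≤ n + (k + j))
    have h₂ := Nat.factorial_mul_descFactorial hk
    rw [show n + (k + j) - j = n + k by omega] at h₁
    rw [Nat.add_sub_cancel_left] at h₂ ⊢
    rw [← h₁, ← h₂]
    push_cast
    ring
  · rw [Nat.descFactorial_of_lt (not_le.1 hk)]
    simp

end ZonalNat

section ZonalInversion

variable {f : SU2 → ℂ}

/-- The zonal function of weight `i.1 : ℤ` in the irreducible representation of dimension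
`2 i.2 + |i.1| + 1`. -/
noncomputable def zonal (i : ℤ × ℕ) (g : SU2) : ℂ :=
  if 0 ≤ i.1 then zonalNat i.1.natAbs i.2 g else conj (zonalNat i.1.natAbs i.2 g)

/-- The dimension of the irreducible representation to which `zonal i` belongs. -/
def dim (i : ℤ × ℕ) : ℕ := 2 * i.2 + i.1.natAbs + 1

theorem zonal_natCast (n k : ℕ) : zonal ((n : ℤ), k) = zonalNat n k := by
  ext g
  simp [zonal]

theorem continuous_zonal (i : ℤ × ℕ) : Continuous (zonal i) := by
  unfold zonal
  split_ifs
  · exact continuous_zonalNat _ _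
  · exact Complex.continuous_conj.comp (continuous_zonalNat _ _)

theorem norm_zonal_le_one (i : ℤ × ℕ) (g : SU2) : ‖zonal i g‖ ≤ 1 := by
  unfold zonal
  split_ifs
  · exact norm_zonalNat_le_one _ _ _
  · rw [RCLike.norm_conj]
    exact norm_zonalNat_le_one _ _ _

theorem conj_zonalNat_zero (k : ℕ) (g : SU2) : conj (zonalNat 0 k g) = zonalNat 0 k g := by
  simp [zonalNat, conj_monomial]

theorem conj_zonal (i : ℤ × ℕ) (g : SU2) : conj (zonal i g) = zonal (-i.1, i.2) g := by
  obtain ⟨n, k⟩ := i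
  simp only [zonal, Int.natAbs_neg]
  rcases lt_trichotomy n 0 with h | rfl | h
  · simp [h.not_ge, h.le]
  · simp [conj_zonalNat_zero]
  · simp [h.le, h]

theorem integral_zonalNat_mul_monomial_eq_zero {n p q r s : ℕ} (k : ℕ)
    (h : n + p ≠ q ∨ r ≠ s) : ∫ g, zonalNat n k g * monomial p q r s g ∂haar = 0 := by
  simp only [zonalNat, Finset.sum_mul, mul_assoc, monomial_mul]
  rw [integral_finsetSum _ fun _ _ => (integrable_monomial _ _ _ _).const_mul _]
  refine Finset.sum_eq_zero fun t ht => ?_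
  have ht : t ≤ k := Finset.mem_range_succ_iff.1 ht
  rw [integral_const_mul, integral_monomial_eq_zero (by omega), mul_zero]

theorem integral_zonal_mul_monomial_eq_zero {i : ℤ × ℕ} {p q r s : ℕ}
    (h : i.1 + p ≠ q ∨ r ≠ s) : ∫ g, zonal i g * monomial p q r s g ∂haar = 0 := by
  unfold zonal
  split_ifs with hn
  · exact integral_zonalNat_mul_monomial_eq_zero i.2 (by omega)
  · have hconj (g : SU2) : conj (zonalNat i.1.natAbs i.2 g) * monomial p q r s g =
        conj (zonalNat i.1.natAbs i.2 g * monomial q p s r g) := by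
      rw [map_mul, conj_monomial]
    simp only [hconj]
    rw [integral_conj, integral_zonalNat_mul_monomial_eq_zero i.2 (by omega), map_zero]

/-- The expansion of `f` in zonal functions converges to `f 1` at the identity. -/
def ZonalInversion (f : SU2 → ℂ) : Prop :=
  HasSum (fun i => (dim i : ℂ) * ∫ g, zonal i g * f g ∂haar) (f 1)

theorem ZonalInversion.conj_comp (hf : ZonalInversion f) :
    ZonalInversion fun g => conj (f g) := by
  have h := ((Equiv.neg ℤ).prodCongr (Equiv.refl ℕ)).hasSum_iff.mpr (Complex.hasSum_conj'.mpr hf)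
  refine h.congr_fun fun i => ?_
  simp only [Function.comp, Equiv.prodCongr_apply, Prod.map, Equiv.neg_apply, Equiv.refl_apply,
    map_mul, ← integral_conj, conj_zonal, dim, Int.natAbs_neg, neg_neg, map_natCast]

theorem ZonalInversion.const_smul (hf : ZonalInversion f) (k : ℂ) : ZonalInversion (k • f) := by
  refine (HasSum.mul_left k hf).congr_fun fun i => ?_
  simp only [Pi.smul_apply, smul_eq_mul, mul_left_comm _ k, integral_const_mul]

theorem ZonalInversion.add {f₁ : SU2 → ℂ} (hf : ZonalInversion f) (hc : Continuous f)
    (hc₁ : Continuous f₁) (hf₁ : ZonalInversion f₁) : ZonalInversion (f + f₁) := by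
  refine (HasSum.add hf hf₁).congr_fun fun i => ?_
  have hI {f : SU2 → ℂ} (hc : Continuous f) : Integrable (fun g => zonal i g * f g) haar :=
    integrable_of_continuous ((continuous_zonal i).mul hc)
  simp only [Pi.add_apply, mul_add]
  rw [integral_add (hI hc) (hI hc₁), mul_add]

theorem zonalInversion_monomial_conj (n p : ℕ) : ZonalInversion (monomial p (p + n) 0 0) := by
  have hzero : ∀ i ∉ ({(n : ℤ)} : Finset ℤ) ×ˢ Finset.range (p + 1),
      (dim i : ℂ) * ∫ g, zonal i g * monomial p (p + n) 0 0 g ∂haar = 0 := by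
    rintro ⟨m, k⟩ hi
    simp only [Finset.mem_product, Finset.mem_singleton, Finset.mem_range, not_and, not_lt] at hi
    by_cases hm : m = n
    · rw [hm, zonal_natCast, integral_zonalNat_mul_monomial, Nat.descFactorial_of_lt (hi hm)]
      simp
    · rw [integral_zonal_mul_monomial_eq_zero (by dsimp only; omega), mul_zero]
  have hone : monomial p (p + n) 0 0 1 = 1 := by simp [monomial, α_one]
  have htelescope := sum_descFactorial_div_factorial n p (p + 1)
  rw [Nat.descFactorial_of_lt (Nat.lt_succ_self p), Nat.cast_zero, zero_mul, zero_div,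
    sub_zero] at htelescope
  have hvalue : ∑ i ∈ ({(n : ℤ)} : Finset ℤ) ×ˢ Finset.range (p + 1),
      (dim i : ℂ) * ∫ g, zonal i g * monomial p (p + n) 0 0 g ∂haar = 1 := by
    rw [Finset.sum_product, Finset.sum_singleton]
    simp only [zonal_natCast, integral_zonalNat_mul_monomial, dim, Int.natAbs_natCast]
    push_cast
    exact htelescope
  unfold ZonalInversion
  rw [hone, ← hvalue]
  exact hasSum_sum_of_ne_finset_zero hzero

theorem zonalInversion_monomial_of_ne {r s : ℕ} (h : r ≠ s) (p q : ℕ) :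
    ZonalInversion (monomial p q r s) := by
  have hone : monomial p q r s 1 = 0 := by
    rcases Nat.eq_zero_or_pos r with rfl | hr
    · simp [monomial, β_one, h.symm]
    · simp [monomial, β_one, hr.ne']
  unfold ZonalInversion
  simp only [hone, integral_zonal_mul_monomial_eq_zero (Or.inr h), mul_zero]
  exact hasSum_zero

theorem zonalInversion_monomial (p q r s : ℕ) : ZonalInversion (monomial p q r s) := by
  by_cases hrs : r = s
  swap
  · exact zonalInversion_monomial_of_ne hrs p q
  subst hrs
  induction r generalizing p q with
  | zero =>
    rcases le_total p q with h | h
    · obtain ⟨n, rfl⟩ := Nat.exists_eq_add_of_le h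
      exact zonalInversion_monomial_conj n p
    · obtain ⟨n, rfl⟩ := Nat.exists_eq_add_of_le h
      simpa only [conj_monomial] using (zonalInversion_monomial_conj n q).conj_comp
  | succ r ih =>
    have hsub : monomial p q (r + 1) (r + 1) =
        monomial p q r r + (-1 : ℂ) • monomial (p + 1) (q + 1) r r := by
      ext g
      simp [← monomial_succ_add p q r r g]
    rw [hsub]
    exact (ih p q).add (continuous_monomial _ _ _ _) ((continuous_monomial _ _ _ _).const_smul _)
      ((ih (p + 1) (q + 1)).const_smul _)

end ZonalInversion

section Polynomial

/-- Complex polynomials in the matrix entries and their conjugates. -/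
noncomputable def complexPoly : Subalgebra ℂ (SU2 → ℂ) :=
  Algebra.adjoin ℂ {α, β, fun g => conj (α g), fun g => conj (β g)}

theorem α_mem_complexPoly : α ∈ complexPoly := Algebra.subset_adjoin (by simp)

theorem β_mem_complexPoly : β ∈ complexPoly := Algebra.subset_adjoin (by simp)

theorem conj_α_mem_complexPoly : (fun g => conj (α g)) ∈ complexPoly :=
  Algebra.subset_adjoin (by simp)

theorem conj_β_mem_complexPoly : (fun g => conj (β g)) ∈ complexPoly :=
  Algebra.subset_adjoin (by simp)

theorem monomial_mem_complexPoly (p q r s : ℕ) : monomial p q r s ∈ complexPoly :=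
  mul_mem (mul_mem (mul_mem (pow_mem α_mem_complexPoly p) (pow_mem conj_α_mem_complexPoly q))
    (pow_mem β_mem_complexPoly r)) (pow_mem conj_β_mem_complexPoly s)

theorem toSubmodule_complexPoly : Subalgebra.toSubmodule complexPoly =
    Submodule.span ℂ {F | ∃ p q r s, F = monomial p q r s} := by
  refine le_antisymm ?_ (Submodule.span_le.2 ?_)
  · rw [complexPoly, Algebra.adjoin_eq_span]
    refine Submodule.span_mono fun F hF => ?_
    induction hF using Submonoid.closure_induction with
    | mem F hF =>
      rcases hF with rfl | rfl | rfl | rfl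
      · exact ⟨1, 0, 0, 0, by ext; simp [monomial]⟩
      · exact ⟨0, 0, 1, 0, by ext; simp [monomial]⟩
      · exact ⟨0, 1, 0, 0, by ext; simp [monomial]⟩
      · exact ⟨0, 0, 0, 1, by ext; simp [monomial]⟩
    | one => exact ⟨0, 0, 0, 0, by ext; simp [monomial]⟩
    | mul F G _ _ hF hG =>
      obtain ⟨p, q, r, s, rfl⟩ := hF
      obtain ⟨p', q', r', s', rfl⟩ := hG
      exact ⟨_, _, _, _, funext fun g => monomial_mul p q r s p' q' r' s' g⟩
  · rintro _ ⟨p, q, r, s, rfl⟩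
    exact monomial_mem_complexPoly p q r s

@[elab_as_elim]
theorem complexPoly_induction {motive : (F : SU2 → ℂ) → F ∈ complexPoly → Prop}
    (monomial : ∀ p q r s, motive (monomial p q r s) (monomial_mem_complexPoly p q r s))
    (zero : motive 0 (zero_mem complexPoly))
    (add : ∀ F G hF hG, motive F hF → motive G hG → motive (F + G) (add_mem hF hG))
    (smul : ∀ (k : ℂ) F hF, motive F hF → motive (k • F) (complexPoly.smul_mem hF k))
    {F : SU2 → ℂ} (hF : F ∈ complexPoly) : motive F hF := by
  have hspan := toSubmodule_complexPoly.ge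
  refine Submodule.span_induction (p := fun F hF => motive F (hspan hF)) ?_ zero
    (fun F G hF hG => add F G (hspan hF) (hspan hG)) (fun k F hF => smul k F (hspan hF))
    (toSubmodule_complexPoly.le hF)
  rintro _ ⟨p, q, r, s, rfl⟩
  exact monomial p q r s

theorem continuous_of_mem_complexPoly {F : SU2 → ℂ} (hF : F ∈ complexPoly) : Continuous F := by
  induction hF using complexPoly_induction with
  | monomial p q r s => exact continuous_monomial p q r s
  | zero => exact continuous_const
  | add F G _ _ hF hG => exact hF.add hG
  | smul k F _ hF => exact hF.const_smul k

theorem conj_mem_complexPoly {F : SU2 → ℂ} (hF : F ∈ complexPoly) :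
    (fun g => conj (F g)) ∈ complexPoly := by
  induction hF using complexPoly_induction with
  | monomial p q r s =>
    simp only [conj_monomial]
    exact monomial_mem_complexPoly q p s r
  | zero =>
    simp only [Pi.zero_apply, map_zero]
    exact zero_mem complexPoly
  | add F G _ _ hF hG => simpa using! add_mem hF hG
  | smul k F _ hF => simpa using! complexPoly.smul_mem hF (conj k)

theorem comp_mul_left_mem_complexPoly {F : SU2 → ℂ} (hF : F ∈ complexPoly) (h : SU2) :
    (fun g => F (h * g)) ∈ complexPoly := by
  have hα : (fun g => α (h * g)) ∈ complexPoly := by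
    simp only [α_mul]
    exact sub_mem (complexPoly.smul_mem α_mem_complexPoly (α h))
      (complexPoly.smul_mem conj_β_mem_complexPoly (β h))
  have hβ : (fun g => β (h * g)) ∈ complexPoly := by
    simp only [β_mul]
    exact add_mem (complexPoly.smul_mem β_mem_complexPoly (α h))
      (complexPoly.smul_mem conj_α_mem_complexPoly (β h))
  induction hF using Algebra.adjoin_induction with
  | mem F hF =>
    rcases hF with rfl | rfl | rfl | rfl
    · exact hα
    · exact hβ
    · exact conj_mem_complexPoly hα
    · exact conj_mem_complexPoly hβ
  | algebraMap k => exact complexPoly.algebraMap_mem k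
  | add F G _ _ hF hG => exact add_mem hF hG
  | mul F G _ _ hF hG => exact mul_mem hF hG

theorem zonalInversion_of_mem_complexPoly {F : SU2 → ℂ} (hF : F ∈ complexPoly) :
    ZonalInversion F := by
  suffices h : Continuous F ∧ ZonalInversion F from h.2
  induction hF using complexPoly_induction with
  | monomial p q r s => exact ⟨continuous_monomial p q r s, zonalInversion_monomial p q r s⟩
  | zero => exact ⟨continuous_const, by simp [ZonalInversion, hasSum_zero]⟩
  | add F G _ _ hF hG => exact ⟨hF.1.add hG.1, hF.2.add hF.1 hG.1 hG.2⟩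
  | smul k F _ hF => exact ⟨hF.1.const_smul k, hF.2.const_smul k⟩

/-- Real polynomials in the real and imaginary parts of the matrix entries. -/
noncomputable def poly : Subalgebra ℝ C(SU2, ℝ) :=
  (complexPoly.restrictScalars ℝ).comap
    ((Complex.ofRealAm.compLeft SU2).comp (ContinuousMap.coeFnAlgHom ℝ))

theorem mem_poly {f : C(SU2, ℝ)} : f ∈ poly ↔ (fun g => (f g : ℂ)) ∈ complexPoly := Iff.rfl

theorem mem_poly_of_eq_re {f : C(SU2, ℝ)} {F : SU2 → ℂ} (hF : F ∈ complexPoly)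
    (hf : ∀ g, f g = (F g).re) : f ∈ poly := by
  have h := complexPoly.smul_mem (add_mem hF (conj_mem_complexPoly hF)) (1 / 2)
  rw [mem_poly]
  convert! h using 1
  ext g
  simp [hf, Complex.add_conj]

theorem comp_mulLeft_mem_poly {f : C(SU2, ℝ)} (hf : f ∈ poly) (h : SU2) :
    f.comp (.mulLeft h) ∈ poly :=
  comp_mul_left_mem_complexPoly (mem_poly.1 hf) h

theorem topologicalClosure_poly : poly.topologicalClosure = ⊤ := by
  refine ContinuousMap.subalgebra_topologicalClosure_eq_top_of_separatesPoints _ fun g h hgh => ?_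
  by_contra! hcon
  have hre {F : SU2 → ℂ} (hF : F ∈ complexPoly) : (F g).re = (F h).re :=
    hcon _ ⟨⟨_, Complex.continuous_re.comp (continuous_of_mem_complexPoly hF)⟩,
      mem_poly_of_eq_re hF fun _ => rfl, rfl⟩
  have heq {F : SU2 → ℂ} (hF : F ∈ complexPoly) : F g = F h :=
    Complex.ext (hre hF) (by simpa using hre (complexPoly.smul_mem hF (-Complex.I)))
  exact hgh (ext_αβ (heq α_mem_complexPoly) (heq β_mem_complexPoly))

/-- The real part of a complex multiple of a monomial. -/
noncomputable def reMonomial (k : ℂ) (p q r s : ℕ) : C(SU2, ℝ) :=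
  ⟨fun g => (k * monomial p q r s g).re, (isSmooth_re_monomial k p q r s).continuous⟩

theorem reMonomial_mem_poly (k : ℂ) (p q r s : ℕ) : reMonomial k p q r s ∈ poly :=
  mem_poly_of_eq_re (complexPoly.smul_mem (monomial_mem_complexPoly p q r s) k) fun _ => rfl

theorem poly_le_of_reMonomial_mem {M : Submodule ℝ C(SU2, ℝ)}
    (hM : ∀ k p q r s, reMonomial k p q r s ∈ M) : Subalgebra.toSubmodule poly ≤ M := by
  have key {F : SU2 → ℂ} (hF : F ∈ complexPoly) (k : ℂ) :
      ∃ f ∈ M, ∀ g, f g = (k * F g).re := by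
    induction hF using complexPoly_induction generalizing k with
    | monomial p q r s => exact ⟨_, hM k p q r s, fun _ => rfl⟩
    | zero => exact ⟨0, M.zero_mem, by simp⟩
    | add F G _ _ hF hG =>
      obtain ⟨f₁, hf₁, h₁⟩ := hF k
      obtain ⟨f₂, hf₂, h₂⟩ := hG k
      exact ⟨f₁ + f₂, M.add_mem hf₁ hf₂, by simp [h₁, h₂, mul_add]⟩
    | smul l F _ hF =>
      obtain ⟨f, hf, h⟩ := hF (k * l)
      exact ⟨f, hf, by simp [h, mul_assoc]⟩
  intro f hf
  obtain ⟨f', hf', h⟩ := key (mem_poly.1 hf) 1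
  obtain rfl : f' = f := ContinuousMap.ext fun g => by simp [h]
  exact hf'

theorem isSmooth_of_mem_poly {f : C(SU2, ℝ)} (hf : f ∈ poly) : IsSmooth f := by
  let smooth : Submodule ℝ C(SU2, ℝ) :=
    { carrier := {f | IsSmooth f}
      add_mem' := IsSmooth.add
      zero_mem' := .const 0
      smul_mem' := fun k _ => IsSmooth.const_smul k }
  exact poly_le_of_reMonomial_mem (M := smooth) isSmooth_re_monomial hf

end Polynomial

section Eigenfunction

/-- The polynomials `f` with `sublaplacian f = μ • f`. -/
def polyEigenspace (μ : ℝ) : Submodule ℝ C(SU2, ℝ) where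
  carrier := {f | f ∈ poly ∧ sublaplacian f = μ • ⇑f}
  add_mem' {f₁ f₂} h₁ h₂ := ⟨add_mem h₁.1 h₂.1, by
    rw [ContinuousMap.coe_add, (isSmooth_of_mem_poly h₁.1).sublaplacian_add
      (isSmooth_of_mem_poly h₂.1), h₁.2, h₂.2, smul_add]⟩
  zero_mem' := ⟨zero_mem poly, by simpa using sublaplacian_const_smul 0 0⟩
  smul_mem' k f hf := ⟨poly.smul_mem hf.1 k, by
    rw [ContinuousMap.coe_smul, sublaplacian_const_smul, hf.2, smul_comm]⟩

/-- The real parts of `k` times the real polynomials homogeneous of degree `N` in the matrix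
entries and their conjugates. -/
noncomputable def homogeneousPoly (k : ℂ) (N : ℕ) : Submodule ℝ C(SU2, ℝ) :=
  .span ℝ {f | ∃ p q r s, p + q + r + s = N ∧ reMonomial k p q r s = f}

theorem reMonomial_mem_homogeneousPoly (k : ℂ) (p q r s : ℕ) :
    reMonomial k p q r s ∈ homogeneousPoly k (p + q + r + s) :=
  Submodule.subset_span ⟨p, q, r, s, rfl, rfl⟩

theorem homogeneousPoly_le_poly (k : ℂ) (N : ℕ) :
    homogeneousPoly k N ≤ Subalgebra.toSubmodule poly :=
  Submodule.span_le.2 <| by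
    rintro _ ⟨p, q, r, s, -, rfl⟩
    exact reMonomial_mem_poly k p q r s

instance instFiniteDimensionalHomogeneousPoly (k : ℂ) (N : ℕ) :
    FiniteDimensional ℝ (homogeneousPoly k N) := by
  refine .span_of_finite ℝ (((Set.finite_Iic (N, N, N, N)).image fun x =>
    reMonomial k x.1 x.2.1 x.2.2.1 x.2.2.2).subset ?_)
  rintro _ ⟨p, q, r, s, hN, rfl⟩
  exact ⟨(p, q, r, s), by simp only [Set.mem_Iic, Prod.mk_le_mk]; omega, rfl⟩

theorem sublaplacian_reMonomial (k : ℂ) (p q r s : ℕ) : sublaplacian (reMonomial k p q r s) =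
    ⇑((-2 * (r * (p + 1) + q * (s + 1) + p * (r + 1) + s * (q + 1)) : ℝ) • reMonomial k p q r s +
      ((4 * r * s : ℝ) • reMonomial k (p + 1) (q + 1) (r - 1) (s - 1) +
      (4 * p * q : ℝ) • reMonomial k (p - 1) (q - 1) (r + 1) (s + 1))) := by
  refine ((hasSublaplacian_monomial p q r s).const_smul k).sublaplacian_re.trans
    (funext fun g => ?_)
  simp [reMonomial]
  ring

theorem exists_sublaplacian_eq_of_mem_homogeneousPoly {k : ℂ} {N : ℕ} {f : C(SU2, ℝ)}
    (hf : f ∈ homogeneousPoly k N) : ∃ f' ∈ homogeneousPoly k N, sublaplacian f = f' := by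
  induction hf using Submodule.span_induction with
  | mem f hf =>
    obtain ⟨p, q, r, s, rfl, rfl⟩ := hf
    refine ⟨_, ?_, sublaplacian_reMonomial k p q r s⟩
    refine add_mem (Submodule.smul_mem _ _ (reMonomial_mem_homogeneousPoly k p q r s))
      (add_mem ?_ ?_)
    · rcases r with _ | r
      · simp
      rcases s with _ | s
      · simp
      exact Submodule.smul_mem _ _ (Submodule.subset_span ⟨_, _, _, _, by omega, rfl⟩)
    · rcases p with _ | p
      · simp
      rcases q with _ | q
      · simp
      exact Submodule.smul_mem _ _ (Submodule.subset_span ⟨_, _, _, _, by omega, rfl⟩)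
  | zero => exact ⟨0, zero_mem _, by simpa using sublaplacian_const_smul 0 0⟩
  | add f₁ f₂ h₁ h₂ ih₁ ih₂ =>
    obtain ⟨f₁', hf₁', hL₁⟩ := ih₁
    obtain ⟨f₂', hf₂', hL₂⟩ := ih₂
    refine ⟨f₁' + f₂', add_mem hf₁' hf₂', ?_⟩
    rw [ContinuousMap.coe_add,
      (isSmooth_of_mem_poly (homogeneousPoly_le_poly k N h₁)).sublaplacian_add
        (isSmooth_of_mem_poly (homogeneousPoly_le_poly k N h₂)), hL₁, hL₂, ContinuousMap.coe_add]
  | smul c f _ ih =>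
    obtain ⟨f', hf', hL⟩ := ih
    exact ⟨c • f', Submodule.smul_mem _ c hf', by
      rw [ContinuousMap.coe_smul, sublaplacian_const_smul, hL, ContinuousMap.coe_smul]⟩

theorem integral_sq_pos {f : C(SU2, ℝ)} (hf : f ≠ 0) : 0 < ∫ g, f g * f g ∂haar := by
  obtain ⟨g, hg⟩ := DFunLike.ne_iff.1 hf
  exact (f.continuous.mul f.continuous).integral_pos_of_hasCompactSupport_nonneg_nonzero
    (.of_compactSpace _) (fun g => mul_self_nonneg (f g)) (mul_self_ne_zero.2 hg)

/-- The `L²` inner product. -/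
noncomputable def l2Form : LinearMap.BilinForm ℝ C(SU2, ℝ) :=
  LinearMap.mk₂ ℝ (fun f h => ∫ g, f g * h g ∂haar)
    (fun f₁ f₂ h => by
      simp only [ContinuousMap.add_apply, add_mul]
      exact integral_add (integrable_of_continuous (f₁ * h).continuous)
        (integrable_of_continuous (f₂ * h).continuous))
    (fun c f h => by simp only [ContinuousMap.smul_apply, smul_mul_assoc, integral_smul])
    (fun f h₁ h₂ => by
      simp only [ContinuousMap.add_apply, mul_add]
      exact integral_add (integrable_of_continuous (f * h₁).continuous)
        (integrable_of_continuous (f * h₂).continuous))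
    (fun c f h => by simp only [ContinuousMap.smul_apply, mul_smul_comm, integral_smul])

theorem homogeneousPoly_le_iSup_polyEigenspace (k : ℂ) (N : ℕ) :
    homogeneousPoly k N ≤ ⨆ μ, polyEigenspace μ := by
  have hsmooth (f : homogeneousPoly k N) := isSmooth_of_mem_poly (homogeneousPoly_le_poly k N f.2)
  choose L hL_mem hL using
    fun f : homogeneousPoly k N => exists_sublaplacian_eq_of_mem_homogeneousPoly f.2
  let T : Module.End ℝ (homogeneousPoly k N) :=
    { toFun := fun f => ⟨L f, hL_mem f⟩
      map_add' := fun f₁ f₂ => Subtype.ext <| DFunLike.coe_injective <| by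
        simpa [← hL] using (hsmooth f₁).sublaplacian_add (hsmooth f₂)
      map_smul' := fun c f => Subtype.ext <| DFunLike.coe_injective <| by
        simpa [← hL] using sublaplacian_const_smul c f }
  have htop := iSup_eigenspace_eq_top_of_symmetric (T := T) (l2Form.restrict _)
    (fun f h => integral_congr_ae <| .of_forall fun g => mul_comm _ _)
    (fun f hf => integral_sq_pos (by simpa using hf))
    (fun f h => by
      have := (hsmooth f).integral_sublaplacian_mul (hsmooth h)
      rwa [hL, hL] at this)
  have hle (μ : ℝ) : (T.eigenspace μ).map (homogeneousPoly k N).subtype ≤ polyEigenspace μ := by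
    rintro _ ⟨f, hf, rfl⟩
    refine ⟨homogeneousPoly_le_poly k N f.2, ?_⟩
    have := congrArg (fun f : homogeneousPoly k N => (f : SU2 → ℝ))
      (Module.End.mem_eigenspace_iff.1 hf)
    exact (hL f).trans this
  calc homogeneousPoly k N = (⊤ : Submodule ℝ (homogeneousPoly k N)).map (Submodule.subtype _) := by
        rw [Submodule.map_top, Submodule.range_subtype]
    _ ≤ ⨆ μ, polyEigenspace μ := by
        rw [← htop, Submodule.map_iSup]
        exact iSup_mono hle

theorem poly_le_iSup_polyEigenspace : Subalgebra.toSubmodule poly ≤ ⨆ μ, polyEigenspace μ :=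
  poly_le_of_reMonomial_mem fun k p q r s =>
    homogeneousPoly_le_iSup_polyEigenspace k _ (reMonomial_mem_homogeneousPoly k p q r s)

theorem exists_sum_polyEigenspace {f : C(SU2, ℝ)} (hf : f ∈ poly) :
    ∃ (t : Finset ℝ) (e : ℝ → C(SU2, ℝ)), (∀ μ, e μ ∈ polyEigenspace μ) ∧ f = ∑ μ ∈ t, e μ := by
  obtain ⟨e, he, hsum⟩ :=
    (Submodule.mem_iSup_iff_exists_finsupp _ _).1 (poly_le_iSup_polyEigenspace hf)
  exact ⟨e.support, e, he, hsum.symm⟩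

theorem dense_poly : Dense {f : C(SU2, ℝ) | f ∈ poly} :=
  fun f => show f ∈ poly.topologicalClosure from topologicalClosure_poly ▸ Algebra.mem_top

theorem dense_span_polyEigenspace :
    Dense (Submodule.span ℝ (⋃ μ, (polyEigenspace μ : Set C(SU2, ℝ))) : Set C(SU2, ℝ)) := by
  rw [← Submodule.iSup_eq_span]
  exact dense_poly.mono poly_le_iSup_polyEigenspace

end Eigenfunction

section HeatKernel

/-- The eigenvalue of minus the sublaplacian on `zonal i`. -/
noncomputable def freq (i : ℤ × ℕ) : ℝ := eigenvalue i.1.natAbs i.2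

theorem natAbs_add_le_freq (i : ℤ × ℕ) : 2 * ((i.1.natAbs : ℝ) + i.2) ≤ freq i := by
  unfold freq eigenvalue
  have hk : (0 : ℝ) ≤ i.2 := i.2.cast_nonneg
  have hprod : 0 ≤ (i.2 : ℝ) * (i.2 + i.1.natAbs) := by positivity
  linarith [hk]

theorem freq_nonneg (i : ℤ × ℕ) : 0 ≤ freq i :=
  le_trans (by positivity) (natAbs_add_le_freq i)

theorem dim_le_one_add_freq (i : ℤ × ℕ) : (dim i : ℝ) ≤ 1 + freq i := by
  have h := natAbs_add_le_freq i
  have hn : (0 : ℝ) ≤ i.1.natAbs := i.1.natAbs.cast_nonneg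
  simp only [dim]
  push_cast
  linarith [hn]

theorem summable_exp_neg_freq {t : ℝ} (ht : 0 < t) :
    Summable fun i => Real.exp (-freq i * t) := by
  have hnat : Summable fun k : ℕ => Real.exp (-t) ^ k :=
    summable_geometric_of_lt_one (Real.exp_nonneg _) (by simpa using ht)
  have hint : Summable fun n : ℤ => Real.exp (-t) ^ n.natAbs :=
    .of_nat_of_neg (by simpa using hnat) (by simpa using hnat)
  refine .of_nonneg_of_le (fun i => Real.exp_nonneg _) (fun i => ?_)
    (hint.mul_of_nonneg hnat (fun n => by positivity) (fun k => by positivity))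
  rw [← pow_add, ← Real.exp_nat_mul, Real.exp_le_exp, Nat.cast_add]
  have hle : (i.1.natAbs : ℝ) + i.2 ≤ freq i := by
    have hnonneg : (0 : ℝ) ≤ i.1.natAbs + i.2 := by positivity
    linarith [natAbs_add_le_freq i, hnonneg]
  linarith [mul_le_mul_of_nonneg_right hle ht.le]

theorem summable_dim_mul_exp {t : ℝ} (ht : 0 < t) :
    Summable fun i => dim i * Real.exp (-freq i * t) := by
  refine .of_nonneg_of_le (fun i => by positivity) (fun i => ?_)
    ((summable_exp_neg_freq (half_pos ht)).mul_left (2 / t * Real.exp (t / 2)))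
  have hfreq : 1 + freq i ≤ 2 / t * Real.exp ((1 + freq i) * (t / 2)) := by
    rw [div_mul_eq_mul_div, le_div_iff₀ ht]
    linarith [Real.add_one_le_exp ((1 + freq i) * (t / 2))]
  calc dim i * Real.exp (-freq i * t)
      ≤ 2 / t * Real.exp ((1 + freq i) * (t / 2)) * Real.exp (-freq i * t) := by
        gcongr
        exact (dim_le_one_add_freq i).trans hfreq
    _ = 2 / t * Real.exp (t / 2) * Real.exp (-freq i * (t / 2)) := by
        rw [mul_assoc, mul_assoc, ← Real.exp_add, ← Real.exp_add]
        ring_nf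

/-- The real part of `zonal i`. -/
noncomputable def reZonal (i : ℤ × ℕ) : C(SU2, ℝ) :=
  ⟨fun g => (zonal i g).re, Complex.continuous_re.comp (continuous_zonal i)⟩

theorem reZonal_apply (i : ℤ × ℕ) (g : SU2) : reZonal i g = (zonalNat i.1.natAbs i.2 g).re := by
  simp only [reZonal, ContinuousMap.coe_mk, zonal]
  split_ifs
  · rfl
  · exact Complex.conj_re _

theorem reZonal_mem_polyEigenspace (i : ℤ × ℕ) : reZonal i ∈ polyEigenspace (-freq i) := by
  have hmem : zonalNat i.1.natAbs i.2 ∈ complexPoly := by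
    rw [zonalNat_eq_sum]
    exact sum_mem fun _ _ => complexPoly.smul_mem (monomial_mem_complexPoly _ _ _ _) _
  refine ⟨mem_poly_of_eq_re hmem (reZonal_apply i), ?_⟩
  rw [funext (reZonal_apply i), (hasSublaplacian_zonalNat i.1.natAbs i.2).sublaplacian_re]
  ext g
  simp [freq]

theorem abs_reZonal_le_one (i : ℤ × ℕ) (g : SU2) : |reZonal i g| ≤ 1 :=
  (Complex.abs_re_le_norm _).trans (norm_zonal_le_one i g)

/-- The coefficient of `f` along `reZonal i`. -/
noncomputable def coeff (i : ℤ × ℕ) (f : C(SU2, ℝ)) : ℝ := ∫ g, reZonal i g * f g ∂haar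

theorem coeff_of_sublaplacian_eq {f f' : C(SU2, ℝ)} (hf : IsSmooth f) (hf' : sublaplacian f = f')
    (i : ℤ × ℕ) : coeff i f' = -freq i * coeff i f := by
  obtain ⟨hpoly, heigen⟩ := reZonal_mem_polyEigenspace i
  unfold coeff
  rw [← hf', ← (isSmooth_of_mem_poly hpoly).integral_sublaplacian_mul hf, heigen,
    ← integral_const_mul]
  simp only [Pi.smul_apply, smul_eq_mul, mul_assoc]

theorem hasSum_dim_mul_coeff {f : C(SU2, ℝ)} (hf : f ∈ poly) :
    HasSum (fun i => dim i * coeff i f) (f 1) := by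
  refine (Complex.hasSum_re (zonalInversion_of_mem_complexPoly (mem_poly.1 hf))).congr_fun
    fun i => ?_
  have hre : ∫ g, (zonal i g * (f g : ℂ)).re ∂haar = (∫ g, zonal i g * (f g : ℂ) ∂haar).re :=
    integral_re (𝕜 := ℂ) (integrable_of_continuous ((continuous_zonal i).mul (by fun_prop)))
  rw [← Complex.ofReal_natCast, Complex.re_ofReal_mul, ← hre, coeff]
  simp [reZonal]

/-- The subelliptic heat kernel issued from the identity. -/
noncomputable def kernel (t : ℝ) (g : SU2) : ℝ :=
  ∑' i, dim i * Real.exp (-freq i * t) * reZonal i g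

theorem norm_kernel_term_le (t : ℝ) (i : ℤ × ℕ) (g : SU2) :
    ‖dim i * Real.exp (-freq i * t) * reZonal i g‖ ≤ dim i * Real.exp (-freq i * t) := by
  rw [norm_mul, Real.norm_of_nonneg (by positivity), Real.norm_eq_abs]
  exact mul_le_of_le_one_right (by positivity) (abs_reZonal_le_one i g)

theorem continuous_kernel {t : ℝ} (ht : 0 < t) : Continuous (kernel t) :=
  continuous_tsum (fun i => (reZonal i).continuous.const_mul _) (summable_dim_mul_exp ht)
    fun i g => norm_kernel_term_le t i g

theorem hasSum_integral_kernel {t : ℝ} (ht : 0 < t) (f : C(SU2, ℝ)) :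
    HasSum (fun i => dim i * Real.exp (-freq i * t) * coeff i f)
      (∫ g, kernel t g * f g ∂haar) := by
  have hbound (i : ℤ × ℕ) (g : SU2) :
      ‖dim i * Real.exp (-freq i * t) * reZonal i g * f g‖ ≤
        dim i * Real.exp (-freq i * t) * ‖f‖ := by
    rw [norm_mul]
    exact mul_le_mul (norm_kernel_term_le t i g) (f.norm_coe_le_norm g) (norm_nonneg _)
      (by positivity)
  have hcont (i : ℤ × ℕ) :
      Continuous fun g => dim i * Real.exp (-freq i * t) * reZonal i g * f g := by fun_prop
  have h := hasSum_integral_of_dominated_convergence (μ := haar)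
    (fun i _ => dim i * Real.exp (-freq i * t) * ‖f‖)
    (fun i => (hcont i).aestronglyMeasurable) (fun i => .of_forall (hbound i))
    (.of_forall fun _ => (summable_dim_mul_exp ht).mul_right _) (integrable_const _)
    (.of_forall fun g => ((Summable.of_norm_bounded (summable_dim_mul_exp ht)
      fun i => norm_kernel_term_le t i g).hasSum.mul_right (f g)))
  refine h.congr_fun fun i => ?_
  simp only [coeff, mul_assoc, integral_const_mul]

theorem integral_kernel_mul_of_mem_polyEigenspace {t : ℝ} (ht : 0 < t) {μ : ℝ} {f : C(SU2, ℝ)}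
    (hf : f ∈ polyEigenspace μ) : ∫ g, kernel t g * f g ∂haar = Real.exp (μ * t) * f 1 := by
  refine (hasSum_integral_kernel ht f).unique ?_
  refine ((hasSum_dim_mul_coeff hf.1).mul_left (Real.exp (μ * t))).congr_fun fun i => ?_
  have hcoeff : (μ + freq i) * coeff i f = 0 := by
    have h := coeff_of_sublaplacian_eq (f' := μ • f) (isSmooth_of_mem_poly hf.1) hf.2 i
    have hsmul : coeff i (μ • f) = μ * coeff i f := by
      simp only [coeff, ContinuousMap.smul_apply, smul_eq_mul, mul_left_comm _ μ,
        integral_const_mul]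
    linear_combination h - hsmul
  rcases mul_eq_zero.1 hcoeff with h | h
  · rw [eq_neg_of_add_eq_zero_left h]
    ring
  · rw [h]
    ring

theorem hasDerivAt_integral_kernel {t : ℝ} (ht : 0 < t) {f f' : C(SU2, ℝ)} (hf : IsSmooth f)
    (hf' : sublaplacian f = f') :
    HasDerivAt (fun s => ∫ g, kernel s g * f g ∂haar) (∫ g, kernel t g * f' g ∂haar) t := by
  have hsum {s : ℝ} (hs : 0 < s) (u : C(SU2, ℝ)) :
      HasSum (fun i => dim i * coeff i u * Real.exp (-freq i * s)) (∫ g, kernel s g * u g ∂haar) :=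
    (hasSum_integral_kernel hs u).congr_fun fun i => mul_right_comm _ _ _
  have hterm (i : ℤ × ℕ) : dim i * coeff i f' = -freq i * (dim i * coeff i f) := by
    rw [coeff_of_sublaplacian_eq hf hf']
    ring
  have hd := hasDerivAt_tsum_mul_exp_neg (c := fun i => dim i * coeff i f) freq_nonneg
    (half_lt_self ht) (hsum ht f).summable
    ((hsum (half_pos ht) f').summable.neg.congr fun i => by rw [hterm]; ring)
  simp only [← hterm, (hsum ht f').tsum_eq] at hd
  refine hd.congr_of_eventuallyEq ?_
  filter_upwards [lt_mem_nhds ht] with s hs using (hsum hs f).tsum_eq.symm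

end HeatKernel

section Heat

instance instFirstCountableTopology : FirstCountableTopology SU2 :=
  have : FirstCountableTopology (Matrix (Fin 2) (Fin 2) ℂ) :=
    inferInstanceAs (FirstCountableTopology (Fin 2 → Fin 2 → ℂ))
  Topology.IsInducing.subtypeVal.firstCountableTopology

/-- The operator `f ↦ ∫ p(h) f(· h) dh`. -/
noncomputable def convOp (p : C(SU2, ℝ)) : C(SU2, ℝ) →L[ℝ] C(SU2, ℝ) :=
  LinearMap.mkContinuous
    { toFun := fun f => ⟨fun g => ∫ h, p h * f (g * h) ∂haar, by
        have hcont : Continuous (Function.uncurry fun g h : SU2 => p h * f (g * h)) := by fun_prop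
        simpa using continuous_parametric_integral_of_continuous hcont isCompact_univ (μ := haar)⟩
      map_add' := fun f₁ f₂ => by
        ext g
        have hI (f : C(SU2, ℝ)) : Integrable (fun h => p h * f (g * h)) haar :=
          integrable_of_continuous (by fun_prop)
        simp only [ContinuousMap.coe_mk, ContinuousMap.add_apply, mul_add]
        exact integral_add (hI f₁) (hI f₂)
      map_smul' := fun c f => by
        ext g
        simp only [ContinuousMap.coe_mk, ContinuousMap.smul_apply, smul_eq_mul, RingHom.id_apply,
          mul_left_comm _ c, integral_const_mul] }
    ‖p‖ fun f => by
      refine (ContinuousMap.norm_le _ (by positivity)).2 fun g => ?_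
      have hbound (h : SU2) : ‖p h * f (g * h)‖ ≤ ‖p‖ * ‖f‖ :=
        norm_mul_le_of_le (p.norm_coe_le_norm h) (f.norm_coe_le_norm _)
      simpa using norm_integral_le_of_norm_le_const (μ := haar) (.of_forall hbound)

open Classical in
/-- The subelliptic heat semigroup, defined for `t > 0` by convolution with the heat kernel. -/
noncomputable def heat (t : ℝ≥0) : C(SU2, ℝ) →L[ℝ] C(SU2, ℝ) :=
  if ht : 0 < t then convOp ⟨kernel t, continuous_kernel (NNReal.coe_pos.2 ht)⟩ else
    ContinuousLinearMap.id ℝ _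

theorem heat_zero : heat 0 = ContinuousLinearMap.id ℝ _ := by simp [heat]

theorem heat_apply {t : ℝ≥0} (ht : 0 < t) (f : C(SU2, ℝ)) (g : SU2) :
    heat t f g = ∫ h, kernel t h * f (g * h) ∂haar := by
  rw [heat, dif_pos ht]
  rfl

theorem comp_mulLeft_mem_polyEigenspace {μ : ℝ} {f : C(SU2, ℝ)} (hf : f ∈ polyEigenspace μ)
    (g : SU2) : f.comp (.mulLeft g) ∈ polyEigenspace μ := by
  refine ⟨comp_mulLeft_mem_poly hf.1 g, ?_⟩
  have h := sublaplacian_comp_mul_left f g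
  rw [hf.2] at h
  exact h

theorem heat_of_mem_polyEigenspace (t : ℝ≥0) {μ : ℝ} {f : C(SU2, ℝ)}
    (hf : f ∈ polyEigenspace μ) : heat t f = Real.exp (μ * t) • f := by
  rcases eq_zero_or_pos t with rfl | ht
  · simp [heat_zero]
  · ext g
    rw [heat_apply ht]
    simpa using! integral_kernel_mul_of_mem_polyEigenspace (NNReal.coe_pos.2 ht)
      (comp_mulLeft_mem_polyEigenspace hf g)

end Heat

section ParabolicMaximumPrinciple

theorem le_of_deriv_le_sublaplacian {u u' : ℝ → SU2 → ℝ} {T M : ℝ} (hT : 0 ≤ T)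
    (hu : ContinuousOn (fun x : ℝ × SU2 => u x.1 x.2) (Set.Icc 0 T ×ˢ Set.univ))
    (hsmooth : ∀ s ∈ Set.Ioc 0 T, IsSmooth (u s))
    (hderiv : ∀ s ∈ Set.Ioc 0 T, ∀ g, HasDerivAt (fun x => u x g) (u' s g) s)
    (hle : ∀ s ∈ Set.Ioc 0 T, ∀ g, u' s g ≤ sublaplacian (u s) g)
    (hM : ∀ g, u 0 g ≤ M) (g : SU2) : u T g ≤ M := by
  suffices h : ∀ ε > 0, u T g - ε * T ≤ M by
    have hlim : Filter.Tendsto (fun ε => u T g - ε * T) (𝓝[>] 0) (𝓝 (u T g)) :=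
      tendsto_nhdsWithin_of_tendsto_nhds
        ((by fun_prop : Continuous fun ε => u T g - ε * T).tendsto' 0 _ (by ring))
    exact le_of_tendsto hlim (by filter_upwards [self_mem_nhdsWithin] with ε hε using h ε hε)
  intro ε hε
  obtain ⟨⟨s, h⟩, ⟨hs, -⟩, hmax⟩ := (isCompact_Icc.prod isCompact_univ).exists_isMaxOn
    ⟨(0, g), ⟨⟨le_rfl, hT⟩, trivial⟩⟩
    (hu.sub (by fun_prop : Continuous fun x : ℝ × SU2 => ε * x.1).continuousOn)
  replace hmax (x : ℝ) (hx : x ∈ Set.Icc 0 T) (k : SU2) : u x k - ε * x ≤ u s h - ε * s :=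
    hmax (a := (x, k)) ⟨hx, trivial⟩
  obtain rfl | hpos := eq_or_lt_of_le hs.1
  · calc u T g - ε * T ≤ u 0 h - ε * 0 := hmax T ⟨hT, le_rfl⟩ g
      _ ≤ M := by simpa using hM h
  · -- at an interior maximum of `u - ε s` one has `∂ₛ u ≥ ε > 0 ≥ L u`
    have hs' : s ∈ Set.Ioc 0 T := ⟨hpos, hs.2⟩
    have hd : HasDerivAt (fun x => u x h - ε * x) (u' s h - ε) s := by
      simpa using (hderiv s hs' h).fun_sub ((hasDerivAt_id s).const_mul ε)
    have htime : 0 ≤ u' s h - ε := nonneg_of_hasDerivAt_of_forall_le hd hpos fun x hx =>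
      hmax x ⟨hx.1, hx.2.le.trans hs.2⟩ h
    have hspace : sublaplacian (u s) h ≤ 0 := (hsmooth s hs').sublaplacian_nonpos fun k => by
      linarith [hmax s hs k]
    linarith [hle s hs' h]

end ParabolicMaximumPrinciple

section HeatSemigroup

theorem IsSmooth.sublaplacian_sum {ι : Type*} {f : ι → SU2 → ℝ} (hf : ∀ i, IsSmooth (f i))
    (t : Finset ι) : SU2.sublaplacian (∑ i ∈ t, f i) = ∑ i ∈ t, SU2.sublaplacian (f i) := by
  classical
  suffices h : IsSmooth (∑ i ∈ t, f i) ∧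
      SU2.sublaplacian (∑ i ∈ t, f i) = ∑ i ∈ t, SU2.sublaplacian (f i) from h.2
  induction t using Finset.induction_on with
  | empty => exact ⟨.const 0, by simpa using sublaplacian_const_smul 0 0⟩
  | insert a t ha ih =>
    rw [Finset.sum_insert ha, Finset.sum_insert ha]
    exact ⟨(hf a).add ih.1, by rw [(hf a).sublaplacian_add ih.1, ih.2]⟩

theorem sum_exp_mul_le {e : ℝ → C(SU2, ℝ)} (he : ∀ μ, e μ ∈ polyEigenspace μ) (t : Finset ℝ)
    {M T : ℝ} (hT : 0 ≤ T) (hM : ∀ g, ∑ μ ∈ t, e μ g ≤ M) (g : SU2) :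
    ∑ μ ∈ t, Real.exp (μ * T) * e μ g ≤ M := by
  have hmem (s μ : ℝ) : Real.exp (μ * s) • e μ ∈ polyEigenspace μ := Submodule.smul_mem _ _ (he μ)
  have hu (s : ℝ) : (fun g => ∑ μ ∈ t, Real.exp (μ * s) * e μ g) =
      ⇑(∑ μ ∈ t, Real.exp (μ * s) • e μ) := by
    ext g
    simp
  have hL (s : ℝ) (g : SU2) : sublaplacian (fun g => ∑ μ ∈ t, Real.exp (μ * s) * e μ g) g =
      ∑ μ ∈ t, Real.exp (μ * s) * μ * e μ g := by
    rw [hu, ContinuousMap.coe_sum,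
      IsSmooth.sublaplacian_sum (fun μ => isSmooth_of_mem_poly (hmem s μ).1)]
    simp only [(hmem s _).2]
    simp [mul_assoc, mul_left_comm]
  refine le_of_deriv_le_sublaplacian (u := fun s g => ∑ μ ∈ t, Real.exp (μ * s) * e μ g)
    (u' := fun s g => ∑ μ ∈ t, Real.exp (μ * s) * μ * e μ g) hT (by fun_prop) (fun s _ => ?_)
    (fun s _ g => HasDerivAt.fun_sum fun μ _ => ?_) (fun s _ g => (hL s g).ge)
    (by simpa using hM) g
  · exact hu s ▸ isSmooth_of_mem_poly (sum_mem fun μ _ => (hmem s μ).1)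
  · simpa using (((hasDerivAt_id s).const_mul μ).exp).mul_const (e μ g)

theorem heat_sum_of_mem_polyEigenspace {e : ℝ → C(SU2, ℝ)} (he : ∀ μ, e μ ∈ polyEigenspace μ)
    (s : Finset ℝ) (t : ℝ≥0) : heat t (∑ μ ∈ s, e μ) = ∑ μ ∈ s, Real.exp (μ * t) • e μ := by
  simp only [map_sum, heat_of_mem_polyEigenspace t (he _)]

theorem heat_apply_le_of_mem_poly {f : C(SU2, ℝ)} (hf : f ∈ poly) {M : ℝ} (hM : ∀ g, f g ≤ M)
    (t : ℝ≥0) (g : SU2) : heat t f g ≤ M := by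
  obtain ⟨s, e, he, rfl⟩ := exists_sum_polyEigenspace hf
  rw [heat_sum_of_mem_polyEigenspace he]
  simp only [ContinuousMap.coe_sum, ContinuousMap.coe_smul, Finset.sum_apply, Pi.smul_apply,
    smul_eq_mul] at hM ⊢
  exact sum_exp_mul_le he s t.coe_nonneg hM g

theorem norm_heat_le (t : ℝ≥0) (f : C(SU2, ℝ)) : ‖heat t f‖ ≤ ‖f‖ := by
  have hclosed : IsClosed {f | ‖heat t f‖ ≤ ‖f‖} := isClosed_le (by fun_prop) continuous_norm
  refine hclosed.closure_subset_iff.2 (fun f hf => ?_) (dense_poly f)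
  refine (ContinuousMap.norm_le _ (norm_nonneg _)).2 fun g => abs_le'.2 ⟨?_, ?_⟩
  · exact heat_apply_le_of_mem_poly hf (fun h => f.apply_le_norm h) t g
  · have h := heat_apply_le_of_mem_poly (neg_mem hf) (M := ‖f‖)
      (fun h => neg_le.1 (f.neg_norm_le_apply h)) t g
    rwa [map_neg] at h

theorem clm_ext_polyEigenspace {A B : C(SU2, ℝ) →L[ℝ] C(SU2, ℝ)}
    (h : ∀ μ, ∀ f ∈ polyEigenspace μ, A f = B f) : A = B := by
  refine ContinuousLinearMap.ext_on dense_span_polyEigenspace fun f hf => ?_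
  obtain ⟨μ, hμ⟩ := Set.mem_iUnion.1 hf
  exact h μ f hμ

theorem heat_add (s t : ℝ≥0) : heat (s + t) = (heat s).comp (heat t) := by
  refine clm_ext_polyEigenspace fun μ f hf => ?_
  rw [ContinuousLinearMap.comp_apply, heat_of_mem_polyEigenspace _ hf,
    heat_of_mem_polyEigenspace _ hf, map_smul, heat_of_mem_polyEigenspace _ hf, smul_smul,
    ← Real.exp_add, NNReal.coe_add, mul_add, add_comm]

theorem continuous_heat (f : C(SU2, ℝ)) : Continuous fun t => heat t f := by
  refine continuous_of_uniform_approx_of_continuous fun u hu => ?_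
  obtain ⟨ε, hε, hεu⟩ := Metric.mem_uniformity_dist.1 hu
  obtain ⟨f', hff', hf'⟩ := Metric.dense_iff.1 dense_poly f ε hε
  refine ⟨fun t => heat t f', ?_, fun t => hεu ?_⟩
  · obtain ⟨s, e, he, rfl⟩ := exists_sum_polyEigenspace hf'
    simp only [heat_sum_of_mem_polyEigenspace he]
    fun_prop
  · calc dist (heat t f) (heat t f') = ‖heat t (f - f')‖ := by rw [dist_eq_norm, map_sub]
      _ ≤ ‖f - f'‖ := norm_heat_le t _
      _ < ε := by rwa [← dist_eq_norm, dist_comm]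

theorem hasDerivAt_heat_apply {f f' : C(SU2, ℝ)} (hf : IsSmooth f) (hf' : sublaplacian f = f')
    (g : SU2) {t : ℝ} (ht : 0 < t) :
    HasDerivAt (fun s : ℝ => heat s.toNNReal f g) (heat t.toNNReal f' g) t := by
  have heq {s : ℝ} (hs : 0 < s) (u : C(SU2, ℝ)) :
      heat s.toNNReal u g = ∫ h, kernel s h * u.comp (.mulLeft g) h ∂haar := by
    rw [heat_apply (Real.toNNReal_pos.2 hs), Real.coe_toNNReal _ hs.le]
    rfl
  have hL : sublaplacian (f.comp (.mulLeft g)) = f'.comp (.mulLeft g) := by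
    have h := sublaplacian_comp_mul_left f g
    rw [hf'] at h
    exact h
  rw [heq ht]
  refine (hasDerivAt_integral_kernel ht (hf.comp_mul_left g) hL).congr_of_eventuallyEq ?_
  filter_upwards [lt_mem_nhds ht] with s hs using heq hs f

theorem exists_heat_sub_div_eq {f f' : C(SU2, ℝ)} (hf : IsSmooth f) (hf' : sublaplacian f = f')
    {t : ℝ≥0} (ht : 0 < t) (g : SU2) : ∃ s < t, (heat t f g - f g) / t = heat s f' g := by
  obtain ⟨s, hs, hslope⟩ := exists_hasDerivAt_eq_slope (fun s : ℝ => heat s.toNNReal f g)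
    (fun s : ℝ => heat s.toNNReal f' g) (NNReal.coe_pos.2 ht)
    ((continuous_eval_const g).comp
      ((continuous_heat f).comp continuous_real_toNNReal)).continuousOn
    (fun s hs => hasDerivAt_heat_apply hf hf' g hs.1)
  refine ⟨s.toNNReal, (Real.toNNReal_lt_iff_lt_coe hs.1.le).2 hs.2, ?_⟩
  simpa [heat_zero] using hslope.symm

theorem heat_generator (f : C(SU2, ℝ)) (hf : IsSmooth f) :
    TendstoUniformly (fun (t : ℝ≥0) (g : SU2) => (heat t f g - f g) / (t : ℝ))
      (sublaplacian f) (𝓝[>] 0) := by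
  obtain ⟨f', hf'⟩ : ∃ f' : C(SU2, ℝ), sublaplacian f = f' := ⟨⟨_, hf.sublaplacian.continuous⟩, rfl⟩
  rw [hf', Metric.tendstoUniformly_iff]
  intro ε hε
  have hnear : ∀ᶠ s in 𝓝 (0 : ℝ≥0), dist f' (heat s f') < ε := by
    have h : Continuous fun s => dist f' (heat s f') := continuous_const.dist (continuous_heat f')
    exact h.continuousAt.eventually_lt continuousAt_const (by simpa [heat_zero] using hε)
  obtain ⟨δ, hδ, hnear⟩ := exists_Ico_subset_of_mem_nhds hnear ⟨1, one_pos⟩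
  filter_upwards [Ioo_mem_nhdsGT hδ] with t ht g
  obtain ⟨s, hst, hs⟩ := exists_heat_sub_div_eq hf hf' ht.1 g
  rw [hs]
  exact (ContinuousMap.dist_apply_le_dist g).trans_lt (hnear ⟨zero_le, hst.trans ht.2⟩)

theorem isHeatSemigroup_heat : IsHeatSemigroup heat where
  zero := heat_zero
  add := heat_add
  strongly_continuous := continuous_heat
  generator := heat_generator

end HeatSemigroup

section Uniqueness

variable {P : ℝ≥0 → C(SU2, ℝ) →L[ℝ] C(SU2, ℝ)}

theorem IsHeatSemigroup.tendsto_generator (hP : IsHeatSemigroup P) {f f' : C(SU2, ℝ)}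
    (hf : IsSmooth f) (hf' : sublaplacian f = f') :
    Filter.Tendsto (fun t : ℝ≥0 => (t : ℝ)⁻¹ • (P t f - f)) (𝓝[>] 0) (𝓝 f') := by
  rw [ContinuousMap.tendsto_iff_tendstoUniformly, ← hf']
  simpa only [ContinuousMap.coe_smul, ContinuousMap.coe_sub, Pi.smul_def, Pi.sub_apply, smul_eq_mul,
    div_eq_inv_mul] using hP.generator f hf

theorem IsHeatSemigroup.eq_heat (hP : IsHeatSemigroup P) : P = heat := by
  funext t
  refine clm_ext_polyEigenspace fun μ f hf => ?_
  rw [heat_of_mem_polyEigenspace t hf]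
  exact semigroup_apply_eq_exp_smul hP.zero hP.add (hP.strongly_continuous f)
    (hP.tendsto_generator (f' := μ • f) (isSmooth_of_mem_poly hf.1) hf.2) t

theorem isKernelFromOne_kernel : IsKernelFromOne heat fun t => kernel t := fun t ht =>
  ⟨continuous_kernel (NNReal.coe_pos.2 ht), fun f => by simp [heat_apply ht]⟩

theorem eq_of_forall_integral_mul_eq {p q : C(SU2, ℝ)}
    (h : ∀ f : C(SU2, ℝ), ∫ g, p g * f g ∂haar = ∫ g, q g * f g ∂haar) : p = q := by
  by_contra hne
  refine (integral_sq_pos (sub_ne_zero.2 hne)).ne' ?_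
  have hsub : l2Form (p - q) (p - q) = 0 := by
    rw [LinearMap.map_sub₂, sub_eq_zero]
    exact h (p - q)
  exact hsub

theorem IsKernelFromOne.eq_kernel {p : ℝ≥0 → SU2 → ℝ} (hp : IsKernelFromOne heat p) {t : ℝ≥0}
    (ht : 0 < t) : p t = kernel t := by
  obtain ⟨hpcont, hpint⟩ := hp t ht
  obtain ⟨hkcont, hkint⟩ := isKernelFromOne_kernel t ht
  have h : (⟨p t, hpcont⟩ : C(SU2, ℝ)) = ⟨kernel t, hkcont⟩ :=
    eq_of_forall_integral_mul_eq fun f => (hpint f).symm.trans (hkint f)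
  exact congrArg DFunLike.coe h

end Uniqueness

section CylindricCoordinates

theorem zonalNat_eq (n k : ℕ) (g : SU2) : zonalNat n k g = α g ^ n *
    ∑ s ∈ Finset.range (k + 1), ((n + k).choose s : ℂ) * k.choose s *
      Complex.normSq (α g) ^ (k - s) * (Complex.normSq (α g) - 1) ^ s := by
  have hα : α g * conj (α g) - 1 = -(β g * conj (β g)) := by
    linear_combination α_mul_conj_add g
  rw [zonalNat, Finset.mul_sum]
  refine Finset.sum_congr rfl fun s hs => ?_
  obtain ⟨j, rfl⟩ := Nat.exists_eq_add_of_le (Finset.mem_range_succ_iff.1 hs)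
  have hmonomial : monomial (n + j) j s s g =
      α g ^ n * (α g * conj (α g)) ^ j * (β g * conj (β g)) ^ s := by
    simp only [monomial]
    ring
  rw [show n + (s + j) - s = n + j by omega, Nat.add_sub_cancel_left, hmonomial,
    ← Complex.mul_conj, hα, neg_pow (β g * conj (β g)), zonalCoeff]
  push_cast
  ring

variable {r : ℝ}

theorem zonalNat_cyl (hr : Real.cos r ≠ 0) (n k : ℕ) (θ z : ℝ) :
    zonalNat n k (SU2.cyl r θ z) = Complex.exp (Complex.I * n * z) *
      (Real.cos r ^ n * jacobiP k n (Real.cos (2 * r)) : ℝ) := by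
  have hnormSq : Complex.normSq (α (SU2.cyl r θ z)) = Real.cos r ^ 2 := by
    rw [α_cyl, Complex.normSq_eq_norm_sq, norm_mul, mul_comm Complex.I,
      Complex.norm_exp_ofReal_mul_I, mul_one, Complex.norm_real, Real.norm_eq_abs, sq_abs]
  rw [zonalNat_eq, hnormSq, Real.cos_two_mul, jacobiP_eq_sum k n (pow_ne_zero 2 hr), α_cyl,
    mul_pow, ← Complex.exp_nat_mul, show (n : ℂ) * (Complex.I * z) = Complex.I * n * z by ring]
  push_cast
  ring

theorem zonal_cyl (hr : Real.cos r ≠ 0) (i : ℤ × ℕ) (θ z : ℝ) :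
    zonal i (SU2.cyl r θ z) = Complex.exp (Complex.I * i.1 * z) *
      (Real.cos r ^ i.1.natAbs * jacobiP i.2 i.1.natAbs (Real.cos (2 * r)) : ℝ) := by
  rw [zonal, zonalNat_cyl hr]
  split_ifs with hn
  · rw [← Int.cast_natCast, Int.natAbs_of_nonneg hn]
  · rw [map_mul, Complex.conj_ofReal, ← Complex.exp_conj, ← Int.cast_natCast,
      Int.ofNat_natAbs_of_nonpos (not_le.1 hn).le]
    simp

end CylindricCoordinates

section Expansion

theorem hasSum_kernel {t : ℝ} (ht : 0 < t) (g : SU2) :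
    HasSum (fun i => (dim i * Real.exp (-freq i * t) : ℝ) * zonal i g) (kernel t g : ℂ) := by
  set a : ℤ × ℕ → ℂ := fun i => (dim i * Real.exp (-freq i * t) : ℝ) * zonal i g with ha
  have hsum : HasSum a (∑' i, a i) := by
    refine (Summable.of_norm_bounded (summable_dim_mul_exp ht) fun i => ?_).hasSum
    rw [ha, norm_mul, Complex.norm_real, Real.norm_of_nonneg (by positivity)]
    exact mul_le_of_le_one_right (by positivity) (norm_zonal_le_one i g)
  have hre : (∑' i, a i).re = kernel t g := by
    refine (Complex.hasSum_re hsum).tsum_eq.symm.trans (tsum_congr fun i => ?_)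
    rw [ha, Complex.re_ofReal_mul]
    rfl
  have hreal : conj (∑' i, a i) = ∑' i, a i := by
    refine (((Equiv.neg ℤ).prodCongr (Equiv.refl ℕ)).hasSum_iff.2
      (Complex.hasSum_conj'.2 hsum)).unique (hsum.congr_fun fun i => ?_)
    simp only [ha, Function.comp, Equiv.prodCongr_apply, Prod.map, Equiv.neg_apply,
      Equiv.refl_apply, map_mul, Complex.conj_ofReal, conj_zonal, dim, freq, Int.natAbs_neg,
      neg_neg]
  rwa [← Complex.conj_eq_iff_re.1 hreal, hre] at hsum

end Expansion

end SU2

theorem proposition3p1_general :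
    (∃! P : ℝ≥0 → (C(SU2, ℝ) →L[ℝ] C(SU2, ℝ)), SU2.IsHeatSemigroup P) ∧
    ∀ P : ℝ≥0 → (C(SU2, ℝ) →L[ℝ] C(SU2, ℝ)), SU2.IsHeatSemigroup P →
      (∃ p : ℝ≥0 → SU2 → ℝ, SU2.IsKernelFromOne P p) ∧
      ∀ p : ℝ≥0 → SU2 → ℝ, SU2.IsKernelFromOne P p →
        ∀ t : ℝ≥0, 0 < t →
        ∀ r θ z : ℝ, Real.cos r ≠ 0 →
          HasSum (fun nk : ℤ × ℕ =>
              ((2 * (nk.2 : ℂ) + (nk.1.natAbs : ℂ) + 1) *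
                (Real.exp (-(4 * (nk.2 : ℝ) * ((nk.2 : ℝ) + (nk.1.natAbs : ℝ) + 1)
                  + 2 * (nk.1.natAbs : ℝ)) * (t : ℝ)) : ℂ) *
                Complex.exp (Complex.I * (nk.1 : ℂ) * (z : ℂ)) *
                ((Real.cos r ^ nk.1.natAbs *
                  jacobiP nk.2 nk.1.natAbs (Real.cos (2 * r)) : ℝ) : ℂ)))
            ((p t (SU2.cyl r θ z) : ℝ) : ℂ) := by
  refine ⟨⟨SU2.heat, SU2.isHeatSemigroup_heat, fun P hP => hP.eq_heat⟩, fun P hP => ?_⟩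
  obtain rfl := hP.eq_heat
  refine ⟨⟨_, SU2.isKernelFromOne_kernel⟩, fun p hp t ht r θ z hr => ?_⟩
  rw [hp.eq_kernel ht]
  refine (SU2.hasSum_kernel (NNReal.coe_pos.2 ht) (SU2.cyl r θ z)).congr_fun fun i => ?_
  rw [SU2.zonal_cyl hr, SU2.dim, SU2.freq, SU2.eigenvalue]
  push_cast
  ring

theorem proposition3p1 :
    (∃! P : ℝ≥0 → (C(SU2, ℝ) →L[ℝ] C(SU2, ℝ)), SU2.IsHeatSemigroup P) ∧
    ∀ P : ℝ≥0 → (C(SU2, ℝ) →L[ℝ] C(SU2, ℝ)), SU2.IsHeatSemigroup P →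
      (∃ p : ℝ≥0 → SU2 → ℝ, SU2.IsKernelFromOne P p) ∧
      ∀ p : ℝ≥0 → SU2 → ℝ, SU2.IsKernelFromOne P p →
        ∀ t : ℝ≥0, 0 < t →
        ∀ r ∈ Set.Ico 0 (Real.pi / 2), ∀ θ ∈ Set.Icc 0 (2 * Real.pi),
        ∀ z ∈ Set.Icc (-Real.pi) Real.pi,
          HasSum (fun nk : ℤ × ℕ =>
              ((2 * (nk.2 : ℂ) + (nk.1.natAbs : ℂ) + 1) *
                (Real.exp (-(4 * (nk.2 : ℝ) * ((nk.2 : ℝ) + (nk.1.natAbs : ℝ) + 1)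
                  + 2 * (nk.1.natAbs : ℝ)) * (t : ℝ)) : ℂ) *
                Complex.exp (Complex.I * (nk.1 : ℂ) * (z : ℂ)) *
                ((Real.cos r ^ nk.1.natAbs *
                  jacobiP nk.2 nk.1.natAbs (Real.cos (2 * r)) : ℝ) : ℂ)))
            ((p t (SU2.cyl r θ z) : ℝ) : ℂ) := by
  obtain ⟨hexists, hkernel⟩ := proposition3p1_general
  exact ⟨hexists, fun P hP => ⟨(hkernel P hP).1, fun p hp t ht r hr θ _ z _ =>
    (hkernel P hP).2 p hp t ht r θ z
      (Real.cos_pos_of_mem_Ioo ⟨by linarith [hr.1, Real.pi_pos], hr.2⟩).ne'⟩⟩
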